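/- Let $\mathcal D$ be a multifusion category over $\mathbb C$ (a rigid $\mathbb C$-linear abelian monoidal category with finite-dimensional Hom spaces, in which every object is a finite direct sum of simple ones and there are finitely many simple objects up to isomorphism), for instance a unitary one. Letters $a,b,c,\dots$ denote representatives of the simple objects. Consider * the bulk tube algebra $\mathbf{Tube}({}_{\mathcal D}\mathcal D_{\mathcal D})=\bigoplus_{a,b,c,e,f,h}\operatorname{Hom}(c,(a\otimes e)\otimes b)\otimes\operatorname{Hom}((a\otimes f)\otimes b,h)$, spanned by the diagrams with left arc $a$, right arc $b$, and vertices $\mu:c\to d\otimes b$, $\nu:d\to a\otimes e$ (lower half), $\zeta:a\otimes f\to g$, $\gamma:g\otimes b\to h$ (upper half); * the left boundary tube algebra $\tilde{\mathbf L}({}_{\mathcal D}\mathcal D)=\bigoplus_{a,d,e,f,g}\operatorname{Hom}(d,a\otimes e)\otimes\operatorname{Hom}(a\otimes f,g)$ and the right one $\tilde{\mathbf R}(\mathcal D_{\mathcal D})=\bigoplus_{b,c,e,f,h}\operatorname{Hom}(c,e\otimes b)\otimes\operatorname{Hom}(f\otimes b,h)$. In each of them, the product $XY$ puts the diagram $Y$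 inside $X$ (it is $0$ unless the two inner edge labels of $X$ equal the two outer edge labels of $Y$), and the parallel arcs are then fused into simple ones by inserting $\mathrm{id}_{a\otimes a'}=\sum_{k,\alpha}v_\alpha v^\alpha$, with dual bases $v_\alpha\in\operatorname{Hom}(k,a\otimes a')$, $v^\alpha\in\operatorname{Hom}(a\otimes a',k)$. The unit is the sum of the diagrams with trivial arcs over all pairs of edge labels. The coproduct inserts an edge $i$ between the lower and the upper inner edge, sums over $i$ and applies the same resolution of the identity to the arcs together with $i$. The counit joins the two inner edges and the two outer edges (it is $0$ if their labels differ) and takes the scalar by which the resulting endomorphism of the outer edge acts. The crossed product $\tilde{\mathbf R}\Join\tilde{\mathbf L}$ is the quotient of $\tilde{\mathbf R}\otimes\tilde{\mathbf L}$ by the span of all $r\otimes l$ for which the inner edge labels of the diagram $r$ are not equal to the outer edge labels of the diagram $l$. Write $r\Join l$ for the class of $r\otimes l$. Its product is $(r\Join l)(r'\Join l')=\sum rr''\Join l''l'$, where $\sum r''\otimes l''\in\tilde{\mathbf R}\otimes\tilde{\mathbf L}$ is obtained by rebracketing (F-moves) the diagram in which $r'$ is placed inside $l$. Its unit is $1\Join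 1$ and its coproduct is $\Delta(r\Join l)=\sum(r_{(1)}\Join l_{(1)})\otimes(r_{(2)}\Join l_{(2)})$. Then: 1. $\mathbf{Tube}({}_{\mathcal D}\mathcal D_{\mathcal D})$, $\tilde{\mathbf L}({}_{\mathcal D}\mathcal D)$, $\tilde{\mathbf R}(\mathcal D_{\mathcal D})$ and $\tilde{\mathbf R}(\mathcal D_{\mathcal D})\Join\tilde{\mathbf L}({}_{\mathcal D}\mathcal D)$ are unital associative algebras. 2. Adding a trivial right arc defines a linear map $\iota_L:\tilde{\mathbf L}({}_{\mathcal D}\mathcal D)\to\mathbf{Tube}({}_{\mathcal D}\mathcal D_{\mathcal D})$ that preserves product, unit, coproduct and counit. Its image is the span $\mathbf L({}_{\mathcal D}\mathcal D)$ of the bulk diagrams whose right arc is a simple summand of $\mathbf 1$. Its kernel is the span of the diagrams whose outer edges $d,g$ lie in different columns of the canonical grading $\mathcal D=\bigoplus_{i,j}\mathcal D_{i,j}$ (that is, $d\in\mathcal D_{i,j}$, $g\in\mathcal D_{i',j'}$ with $j\ne j'$). In particular $\iota_L$ is an embedding if $\mathbf 1$ is simple. Likewise, adding a trivial left arc defines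 $\iota_R:\tilde{\mathbf R}(\mathcal D_{\mathcal D})\to\mathbf{Tube}({}_{\mathcal D}\mathcal D_{\mathcal D})$, which preserves product, unit, coproduct and counit. Its image is the span $\mathbf R(\mathcal D_{\mathcal D})$ of the bulk diagrams whose left arc is a simple summand of $\mathbf 1$, its kernel is spanned by the diagrams whose outer edges lie in different rows, and it is an embedding if $\mathbf 1$ is simple. 3. There is a linear isomorphism $\Phi:\tilde{\mathbf R}(\mathcal D_{\mathcal D})\Join\tilde{\mathbf L}({}_{\mathcal D}\mathcal D)\to\mathbf{Tube}({}_{\mathcal D}\mathcal D_{\mathcal D})$ given by gluing: it sends the class of (right diagram with vertices $\mu,\gamma$) $\otimes$ (left diagram with vertices $\nu,\zeta$) to the bulk diagram with vertices $\mu,\nu,\zeta,\gamma$ if the inner edge labels of the first equal the outer edge labels of the second, and to $0$ otherwise. Equivalently, $\Phi(r\Join l)=\iota_R(r)\,\iota_L(l)$ for all $r,l$. The map $\Phi$ is an isomorphism of unital algebras and is compatible with comultiplication, $\Delta\circ\Phi=(\Phi\otimes\Phi)\circ\Delta$. -/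

import Mathlib

open CategoryTheory MonoidalCategory Limits
open scoped TensorProduct

universe v u

noncomputable section

namespace TubeAlgebra

attribute [local instance] Abelian.hasFiniteBiproducts

section Category

/-- Isomorphism classes of simple objects. -/
def Irr (C : Type u) [Category.{v} C] [Abelian C] : Type u :=
  {x : Quotient (isIsomorphicSetoid C) // Simple x.out}

instance (C : Type u) [Category.{v} C] [Abelian C] : DecidableEq (Irr C) := Classical.decEq _

/-- The chosen simple object in the isomorphism class `x`. -/
def Irr.obj {C : Type u} [Category.{v} C] [Abelian C] (x : Irr C) : C := x.1.out

/-- A multifusion category over `ℂ`: a rigid, `ℂ`-linear, abelian monoidal category with bilinear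
tensor product and finite-dimensional morphism spaces, in which every object is a finite direct sum
of simple objects, and which has finitely many simple objects up to isomorphism.
The tensor unit need not be simple. -/
class MultifusionCategory (C : Type u) [Category.{v} C] [Abelian C] [Linear ℂ C]
    [MonoidalCategory C] [MonoidalPreadditive C] [MonoidalLinear ℂ C] [RigidCategory C] :
    Prop where
  finiteDimensional_hom : ∀ X Y : C, FiniteDimensional ℂ (X ⟶ Y)
  finite_irr : Finite (Irr C)
  semisimple : ∀ X : C, ∃ (n : ℕ) (Y : Fin n → C), (∀ i, Simple (Y i)) ∧ Nonempty (X ≅ ⨁ Y)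

/-- A decomposition of `X` as a direct sum of the chosen simple objects. With `X = a ⊗ b` the
inclusions and projections are dual bases of the splitting spaces `Hom(c, a ⊗ b)` and of the fusion
spaces `Hom(a ⊗ b, c)`, and `total` is the parallel move `𝟙 = ∑ |a b → c⟩⟨c → a b|`. -/
structure SimpleDecomp {C : Type u} [Category.{v} C] [Abelian C] (X : C) where
  n : ℕ
  label : Fin n → Irr C
  incl : ∀ i, (label i).obj ⟶ X
  proj : ∀ i, X ⟶ (label i).obj
  incl_proj_self : ∀ i, incl i ≫ proj i = 𝟙 _
  incl_proj_ne : ∀ i j, i ≠ j → incl i ≫ proj j = 0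
  total : ∑ i, proj i ≫ incl i = 𝟙 X

/-- The identity if `x = y`, and zero otherwise (the Kronecker delta of edge labels). -/
def edge {C : Type u} [Category.{v} C] [Abelian C] (x y : Irr C) : x.obj ⟶ y.obj :=
  if h : x = y then eqToHom (by rw [h]) else 0

theorem edge_of_ne {C : Type u} [Category.{v} C] [Abelian C] {x y : Irr C} (h : x ≠ y) :
    edge x y = 0 := dif_neg h

end Category

section Algebra

variable {C : Type u} [Category.{v} C] [Abelian C] [Linear ℂ C]
  [MonoidalCategory C] [MonoidalPreadditive C] [MonoidalLinear ℂ C] [RigidCategory C]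

theorem exists_irr_iso (Y : C) (hY : Simple Y) : ∃ x : Irr C, Nonempty (Y ≅ x.obj) := by
  have h : Nonempty ((Quotient.mk (isIsomorphicSetoid C) Y).out ≅ Y) :=
    Quotient.exact (Quotient.out_eq (Quotient.mk (isIsomorphicSetoid C) Y))
  obtain ⟨e⟩ := h
  exact ⟨⟨Quotient.mk (isIsomorphicSetoid C) Y, Simple.of_iso e⟩, ⟨e.symm⟩⟩

variable [MultifusionCategory C]

instance : Fintype (Irr C) :=
  haveI : Finite (Irr C) := MultifusionCategory.finite_irr
  Fintype.ofFinite _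

theorem nonempty_simpleDecomp (X : C) : Nonempty (SimpleDecomp X) := by
  obtain ⟨n, Y, hY, ⟨e⟩⟩ := MultifusionCategory.semisimple X
  choose x hx using fun i => exists_irr_iso (Y i) (hY i)
  let f : ∀ i, Y i ≅ (x i).obj := fun i => (hx i).some
  refine ⟨⟨n, x, fun i => (f i).inv ≫ biproduct.ι Y i ≫ e.inv,
    fun i => e.hom ≫ biproduct.π Y i ≫ (f i).hom, ?_, ?_, ?_⟩⟩
  · intro i
    simp
  · intro i j hij
    simp [biproduct.ι_π_ne_assoc Y hij]
  · have : ∀ i, (e.hom ≫ biproduct.π Y i ≫ (f i).hom) ≫ (f i).inv ≫ biproduct.ι Y i ≫ e.inv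
        = e.hom ≫ (biproduct.π Y i ≫ biproduct.ι Y i) ≫ e.inv := by
      intro i
      simp
    simp only [this]
    rw [← Preadditive.comp_sum, ← Preadditive.sum_comp, biproduct.total]
    simp

/-- A chosen decomposition of `X`; all constructions below are independent of the choice. -/
def decomp (X : C) : SimpleDecomp X := (nonempty_simpleDecomp X).some

/-- The scalar `r` with `f = r • 𝟙`, for an endomorphism `f` of a simple object (written as the
trace of composition with `f` on the one-dimensional space of endomorphisms). -/
def scalar (x : Irr C) : (x.obj ⟶ x.obj) →ₗ[ℂ] ℂ :=
  LinearMap.trace ℂ (x.obj ⟶ x.obj) ∘ₗ Linear.comp x.obj x.obj x.obj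

variable (C)

/-! ### The spaces -/

/-- Edge labels of a bulk tube diagram: left arc `a`, right arc `b`, lower outer edge `c`,
lower inner edge `e`, upper inner edge `f`, upper outer edge `h`. -/
structure TubeLabel where
  (a b c e f h : Irr C)

/-- Edge labels of a left boundary tube diagram: arc `a`, lower outer edge `d`,
lower inner edge `e`, upper inner edge `f`, upper outer edge `g`. -/
structure LLabel where
  (a d e f g : Irr C)

/-- Edge labels of a right boundary tube diagram: arc `b`, lower outer edge `c`,
lower inner edge `e`, upper inner edge `f`, upper outer edge `h`. -/
structure RLabel where
  (b c e f h : Irr C)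

instance : DecidableEq (TubeLabel C) := Classical.decEq _
instance : DecidableEq (LLabel C) := Classical.decEq _
instance : DecidableEq (RLabel C) := Classical.decEq _

variable {C}

/-- Lower halves of tube diagrams. -/
abbrev TubeLabel.Low (t : TubeLabel C) : Type v := t.c.obj ⟶ (t.a.obj ⊗ t.e.obj) ⊗ t.b.obj
/-- Upper halves of tube diagrams. -/
abbrev TubeLabel.Up (t : TubeLabel C) : Type v := (t.a.obj ⊗ t.f.obj) ⊗ t.b.obj ⟶ t.h.obj
/-- Lower vertex of a left boundary diagram. -/
abbrev LLabel.Low (t : LLabel C) : Type v := t.d.obj ⟶ t.a.obj ⊗ t.e.obj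
/-- Upper vertex of a left boundary diagram. -/
abbrev LLabel.Up (t : LLabel C) : Type v := t.a.obj ⊗ t.f.obj ⟶ t.g.obj
/-- Lower vertex of a right boundary diagram. -/
abbrev RLabel.Low (t : RLabel C) : Type v := t.c.obj ⟶ t.e.obj ⊗ t.b.obj
/-- Upper vertex of a right boundary diagram. -/
abbrev RLabel.Up (t : RLabel C) : Type v := t.f.obj ⊗ t.b.obj ⟶ t.h.obj

variable (C)

/-- The bulk tube algebra. A pair of morphisms `p ⊗ q` stands for the diagram whose lower half is
`p` and whose upper half is `q`; the two halves of a diagram are the morphisms they evaluate to, so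
that a trivalent vertex carries its normalization factor and no dimension factors appear in the
structure maps. (If the vertices are `(d_a d_b / d_c) ^ (1/4)` times orthonormal basis vectors, then
the structure constants acquire the usual factors `√(d_a d_a' / d_k)`.) -/
abbrev Tube : Type _ := DirectSum (TubeLabel C) fun t => t.Low ⊗[ℂ] t.Up

/-- The left boundary tube algebra of the regular left module. -/
abbrev LTube : Type _ := DirectSum (LLabel C) fun t => t.Low ⊗[ℂ] t.Up

/-- The right boundary tube algebra of the regular right module. -/
abbrev RTube : Type _ := DirectSum (RLabel C) fun t => t.Low ⊗[ℂ] t.Up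

variable {C}

/-- The element of the bulk tube algebra with the given labels. -/
abbrev tubeOf (t : TubeLabel C) : t.Low ⊗[ℂ] t.Up →ₗ[ℂ] Tube C :=
  DirectSum.lof ℂ (TubeLabel C) (fun t => t.Low ⊗[ℂ] t.Up) t
/-- The element of the left boundary tube algebra with the given labels. -/
abbrev lOf (t : LLabel C) : t.Low ⊗[ℂ] t.Up →ₗ[ℂ] LTube C :=
  DirectSum.lof ℂ (LLabel C) (fun t => t.Low ⊗[ℂ] t.Up) t
/-- The element of the right boundary tube algebra with the given labels. -/
abbrev rOf (t : RLabel C) : t.Low ⊗[ℂ] t.Up →ₗ[ℂ] RTube C :=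
  DirectSum.lof ℂ (RLabel C) (fun t => t.Low ⊗[ℂ] t.Up) t

/-- The bulk diagram with four trivalent vertices `μ : c ⟶ d ⊗ b`, `ν : d ⟶ a ⊗ e`,
`ζ : a ⊗ f ⟶ g`, `γ : g ⊗ b ⟶ h`. -/
def diagram {a b c d e f g h : Irr C} (μ : c.obj ⟶ d.obj ⊗ b.obj) (ν : d.obj ⟶ a.obj ⊗ e.obj)
    (ζ : a.obj ⊗ f.obj ⟶ g.obj) (γ : g.obj ⊗ b.obj ⟶ h.obj) : Tube C :=
  tubeOf ⟨a, b, c, e, f, h⟩ ((μ ≫ ν ▷ b.obj) ⊗ₜ[ℂ] (ζ ▷ b.obj ≫ γ))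

/-- The left boundary diagram with vertices `ν` and `ζ`. -/
def lDiagram {a d e f g : Irr C} (ν : d.obj ⟶ a.obj ⊗ e.obj) (ζ : a.obj ⊗ f.obj ⟶ g.obj) :
    LTube C :=
  lOf ⟨a, d, e, f, g⟩ (ν ⊗ₜ[ℂ] ζ)

/-- The right boundary diagram with vertices `μ` and `γ`. -/
def rDiagram {b c d g h : Irr C} (μ : c.obj ⟶ d.obj ⊗ b.obj) (γ : g.obj ⊗ b.obj ⟶ h.obj) :
    RTube C :=
  rOf ⟨b, c, d, g, h⟩ (μ ⊗ₜ[ℂ] γ)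

/-! ### Diagrams whose arcs carry arbitrary objects -/

/-- A tube diagram whose arcs carry arbitrary objects `A` and `B`, evaluated by the parallel move:
both arcs are decomposed into simple ones. -/
def resolve (A B : C) (c e f h : Irr C) :
    (c.obj ⟶ (A ⊗ e.obj) ⊗ B) ⊗[ℂ] ((A ⊗ f.obj) ⊗ B ⟶ h.obj) →ₗ[ℂ] Tube C :=
  ∑ i : Fin (decomp A).n, ∑ j : Fin (decomp B).n,
    tubeOf ⟨(decomp A).label i, (decomp B).label j, c, e, f, h⟩ ∘ₗ
      TensorProduct.map
        (Linear.rightComp ℂ c.obj (((decomp A).proj i ▷ e.obj) ⊗ₘ (decomp B).proj j))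
        (Linear.leftComp ℂ h.obj (((decomp A).incl i ▷ f.obj) ⊗ₘ (decomp B).incl j))

/-- A left boundary diagram whose arc carries an arbitrary object. -/
def lResolve (A : C) (d e f g : Irr C) :
    (d.obj ⟶ A ⊗ e.obj) ⊗[ℂ] (A ⊗ f.obj ⟶ g.obj) →ₗ[ℂ] LTube C :=
  ∑ i : Fin (decomp A).n,
    lOf ⟨(decomp A).label i, d, e, f, g⟩ ∘ₗ
      TensorProduct.map
        (Linear.rightComp ℂ d.obj ((decomp A).proj i ▷ e.obj))
        (Linear.leftComp ℂ g.obj ((decomp A).incl i ▷ f.obj))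

/-- A right boundary diagram whose arc carries an arbitrary object. -/
def rResolve (B : C) (c e f h : Irr C) :
    (c.obj ⟶ e.obj ⊗ B) ⊗[ℂ] (f.obj ⊗ B ⟶ h.obj) →ₗ[ℂ] RTube C :=
  ∑ i : Fin (decomp B).n,
    rOf ⟨(decomp B).label i, c, e, f, h⟩ ∘ₗ
      TensorProduct.map
        (Linear.rightComp ℂ c.obj (e.obj ◁ (decomp B).proj i))
        (Linear.leftComp ℂ h.obj (f.obj ◁ (decomp B).incl i))

/-! ### The bulk tube algebra: structure maps -/

/-- Rebracketing of two nested pairs of arcs around an edge `x`. -/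
def nest (A A' x B' B : C) :
    (A ⊗ ((A' ⊗ x) ⊗ B')) ⊗ B ≅ ((A ⊗ A') ⊗ x) ⊗ (B' ⊗ B) :=
  whiskerRightIso ((α_ A (A' ⊗ x) B').symm ≪≫ whiskerRightIso (α_ A A' x).symm B') B ≪≫
    α_ ((A ⊗ A') ⊗ x) B' B

/-- Lower half of the stacking of two diagrams, the second one inside the first one. -/
def lowStack (t t' : TubeLabel C) : t.Low →ₗ[ℂ] t'.Low →ₗ[ℂ]
    (t.c.obj ⟶ ((t.a.obj ⊗ t'.a.obj) ⊗ t'.e.obj) ⊗ (t'.b.obj ⊗ t.b.obj)) :=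
  LinearMap.mk₂ ℂ
    (fun p p' => p ≫ (t.a.obj ◁ (edge t.e t'.c ≫ p')) ▷ t.b.obj ≫ (nest _ _ _ _ _).hom)
    (by intros; simp) (by intros; simp) (by intros; simp) (by intros; simp)

/-- Upper half of the stacking of two diagrams, the second one inside the first one. -/
def upStack (t t' : TubeLabel C) : t.Up →ₗ[ℂ] t'.Up →ₗ[ℂ]
    (((t.a.obj ⊗ t'.a.obj) ⊗ t'.f.obj) ⊗ (t'.b.obj ⊗ t.b.obj) ⟶ t.h.obj) :=
  LinearMap.mk₂ ℂ
    (fun q q' => (nest _ _ _ _ _).inv ≫ (t.a.obj ◁ (q' ≫ edge t'.h t.f)) ▷ t.b.obj ≫ q)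
    (by intros; simp) (by intros; simp) (by intros; simp) (by intros; simp)

/-- Multiplication: the second diagram is put inside the first one (zero unless the labels of the
glued edges agree), and the two pairs of parallel arcs are fused. -/
def tubeMul : Tube C →ₗ[ℂ] Tube C →ₗ[ℂ] Tube C :=
  DirectSum.toModule ℂ (TubeLabel C) _ fun t =>
    (DirectSum.toModule ℂ (TubeLabel C) _ fun t' =>
      ((TensorProduct.map₂ (lowStack t t') (upStack t t')).compr₂
        (resolve (t.a.obj ⊗ t'.a.obj) (t'.b.obj ⊗ t.b.obj) t.c t'.e t'.f t.h)).flip).flip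

/-- The unit: the sum over `c` and `h` of the diagrams with both arcs trivial. -/
def tubeOne : Tube C :=
  ∑ c : Irr C, ∑ h : Irr C, resolve (𝟙_ C) (𝟙_ C) c c h h
    (((λ_ c.obj).inv ≫ (ρ_ (𝟙_ C ⊗ c.obj)).inv) ⊗ₜ[ℂ]
      ((ρ_ (𝟙_ C ⊗ h.obj)).hom ≫ (λ_ h.obj).hom))

/-- Comultiplication: an edge `i` is inserted between the lower and the upper inner edge, and the
parallel move is applied to `a`, `i` and `b`. -/
def tubeComul : Tube C →ₗ[ℂ] Tube C ⊗[ℂ] Tube C :=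
  DirectSum.toModule ℂ (TubeLabel C) _ fun t =>
    ∑ i : Irr C, ∑ m : Fin (decomp ((t.a.obj ⊗ i.obj) ⊗ t.b.obj)).n,
      let D := decomp ((t.a.obj ⊗ i.obj) ⊗ t.b.obj)
      let s : TubeLabel C := ⟨t.a, t.b, D.label m, i, t.f, t.h⟩
      let s' : TubeLabel C := ⟨t.a, t.b, t.c, t.e, i, D.label m⟩
      TensorProduct.map (tubeOf s ∘ₗ TensorProduct.mk ℂ s.Low s.Up (D.incl m))
          (tubeOf s' ∘ₗ (TensorProduct.mk ℂ s'.Low s'.Up).flip (D.proj m)) ∘ₗ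
        (TensorProduct.comm ℂ t.Low t.Up).toLinearMap

/-- Counit: the inner edges and the outer edges are closed up, and the resulting diagram is
evaluated, normalized by the dimension of the outer edge. -/
def tubeCounit : Tube C →ₗ[ℂ] ℂ :=
  DirectSum.toModule ℂ (TubeLabel C) _ fun t =>
    scalar t.c ∘ₗ TensorProduct.lift
      ((Linear.comp t.c.obj ((t.a.obj ⊗ t.e.obj) ⊗ t.b.obj) t.c.obj).compl₂
        (Linear.leftComp ℂ t.c.obj ((t.a.obj ◁ edge t.e t.f) ▷ t.b.obj) ∘ₗ
          Linear.rightComp ℂ ((t.a.obj ⊗ t.f.obj) ⊗ t.b.obj) (edge t.h t.c)))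

/-! ### The left boundary tube algebra: structure maps -/

/-- Lower half of the stacking of two left boundary diagrams. -/
def lLowStack (t t' : LLabel C) : t.Low →ₗ[ℂ] t'.Low →ₗ[ℂ]
    (t.d.obj ⟶ (t.a.obj ⊗ t'.a.obj) ⊗ t'.e.obj) :=
  LinearMap.mk₂ ℂ
    (fun p p' => p ≫ t.a.obj ◁ (edge t.e t'.d ≫ p') ≫ (α_ _ _ _).inv)
    (by intros; simp) (by intros; simp) (by intros; simp) (by intros; simp)

/-- Upper half of the stacking of two left boundary diagrams. -/
def lUpStack (t t' : LLabel C) : t.Up →ₗ[ℂ] t'.Up →ₗ[ℂ]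
    ((t.a.obj ⊗ t'.a.obj) ⊗ t'.f.obj ⟶ t.g.obj) :=
  LinearMap.mk₂ ℂ
    (fun q q' => (α_ _ _ _).hom ≫ t.a.obj ◁ (q' ≫ edge t'.g t.f) ≫ q)
    (by intros; simp) (by intros; simp) (by intros; simp) (by intros; simp)

/-- Multiplication of left boundary diagrams. -/
def lMul : LTube C →ₗ[ℂ] LTube C →ₗ[ℂ] LTube C :=
  DirectSum.toModule ℂ (LLabel C) _ fun t =>
    (DirectSum.toModule ℂ (LLabel C) _ fun t' =>
      ((TensorProduct.map₂ (lLowStack t t') (lUpStack t t')).compr₂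
        (lResolve (t.a.obj ⊗ t'.a.obj) t.d t'.e t'.f t.g)).flip).flip

/-- The unit of the left boundary tube algebra. -/
def lOne : LTube C :=
  ∑ d : Irr C, ∑ g : Irr C, lResolve (𝟙_ C) d d g g ((λ_ d.obj).inv ⊗ₜ[ℂ] (λ_ g.obj).hom)

/-- Comultiplication of left boundary diagrams. -/
def lComul : LTube C →ₗ[ℂ] LTube C ⊗[ℂ] LTube C :=
  DirectSum.toModule ℂ (LLabel C) _ fun t =>
    ∑ i : Irr C, ∑ m : Fin (decomp (t.a.obj ⊗ i.obj)).n,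
      let D := decomp (t.a.obj ⊗ i.obj)
      let s : LLabel C := ⟨t.a, D.label m, i, t.f, t.g⟩
      let s' : LLabel C := ⟨t.a, t.d, t.e, i, D.label m⟩
      TensorProduct.map (lOf s ∘ₗ TensorProduct.mk ℂ s.Low s.Up (D.incl m))
          (lOf s' ∘ₗ (TensorProduct.mk ℂ s'.Low s'.Up).flip (D.proj m)) ∘ₗ
        (TensorProduct.comm ℂ t.Low t.Up).toLinearMap

/-- Counit of the left boundary tube algebra. -/
def lCounit : LTube C →ₗ[ℂ] ℂ :=
  DirectSum.toModule ℂ (LLabel C) _ fun t =>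
    scalar t.d ∘ₗ TensorProduct.lift
      ((Linear.comp t.d.obj (t.a.obj ⊗ t.e.obj) t.d.obj).compl₂
        (Linear.leftComp ℂ t.d.obj (t.a.obj ◁ edge t.e t.f) ∘ₗ
          Linear.rightComp ℂ (t.a.obj ⊗ t.f.obj) (edge t.g t.d)))

/-! ### The right boundary tube algebra: structure maps -/

/-- Lower half of the stacking of two right boundary diagrams. -/
def rLowStack (t t' : RLabel C) : t.Low →ₗ[ℂ] t'.Low →ₗ[ℂ]
    (t.c.obj ⟶ t'.e.obj ⊗ (t'.b.obj ⊗ t.b.obj)) :=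
  LinearMap.mk₂ ℂ
    (fun p p' => p ≫ (edge t.e t'.c ≫ p') ▷ t.b.obj ≫ (α_ _ _ _).hom)
    (by intros; simp) (by intros; simp) (by intros; simp) (by intros; simp)

/-- Upper half of the stacking of two right boundary diagrams. -/
def rUpStack (t t' : RLabel C) : t.Up →ₗ[ℂ] t'.Up →ₗ[ℂ]
    (t'.f.obj ⊗ (t'.b.obj ⊗ t.b.obj) ⟶ t.h.obj) :=
  LinearMap.mk₂ ℂ
    (fun q q' => (α_ _ _ _).inv ≫ (q' ≫ edge t'.h t.f) ▷ t.b.obj ≫ q)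
    (by intros; simp) (by intros; simp) (by intros; simp) (by intros; simp)

/-- Multiplication of right boundary diagrams. -/
def rMul : RTube C →ₗ[ℂ] RTube C →ₗ[ℂ] RTube C :=
  DirectSum.toModule ℂ (RLabel C) _ fun t =>
    (DirectSum.toModule ℂ (RLabel C) _ fun t' =>
      ((TensorProduct.map₂ (rLowStack t t') (rUpStack t t')).compr₂
        (rResolve (t'.b.obj ⊗ t.b.obj) t.c t'.e t'.f t.h)).flip).flip

/-- The unit of the right boundary tube algebra. -/
def rOne : RTube C :=
  ∑ c : Irr C, ∑ h : Irr C, rResolve (𝟙_ C) c c h h ((ρ_ c.obj).inv ⊗ₜ[ℂ] (ρ_ h.obj).hom)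

/-- Comultiplication of right boundary diagrams. -/
def rComul : RTube C →ₗ[ℂ] RTube C ⊗[ℂ] RTube C :=
  DirectSum.toModule ℂ (RLabel C) _ fun t =>
    ∑ i : Irr C, ∑ m : Fin (decomp (i.obj ⊗ t.b.obj)).n,
      let D := decomp (i.obj ⊗ t.b.obj)
      let s : RLabel C := ⟨t.b, D.label m, i, t.f, t.h⟩
      let s' : RLabel C := ⟨t.b, t.c, t.e, i, D.label m⟩
      TensorProduct.map (rOf s ∘ₗ TensorProduct.mk ℂ s.Low s.Up (D.incl m))
          (rOf s' ∘ₗ (TensorProduct.mk ℂ s'.Low s'.Up).flip (D.proj m)) ∘ₗ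
        (TensorProduct.comm ℂ t.Low t.Up).toLinearMap

/-- Counit of the right boundary tube algebra. -/
def rCounit : RTube C →ₗ[ℂ] ℂ :=
  DirectSum.toModule ℂ (RLabel C) _ fun t =>
    scalar t.c ∘ₗ TensorProduct.lift
      ((Linear.comp t.c.obj (t.e.obj ⊗ t.b.obj) t.c.obj).compl₂
        (Linear.leftComp ℂ t.c.obj (edge t.e t.f ▷ t.b.obj) ∘ₗ
          Linear.rightComp ℂ (t.f.obj ⊗ t.b.obj) (edge t.h t.c)))

/-! ### The boundary tube algebras inside the bulk tube algebra -/

/-- The natural map from the left boundary tube algebra: a trivial right arc is added. -/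
def lToTube : LTube C →ₗ[ℂ] Tube C :=
  DirectSum.toModule ℂ (LLabel C) _ fun t =>
    resolve t.a.obj (𝟙_ C) t.d t.e t.f t.g ∘ₗ
      TensorProduct.map
        (Linear.rightComp ℂ t.d.obj (ρ_ (t.a.obj ⊗ t.e.obj)).inv)
        (Linear.leftComp ℂ t.g.obj (ρ_ (t.a.obj ⊗ t.f.obj)).hom)

/-- The natural map from the right boundary tube algebra: a trivial left arc is added. -/
def rToTube : RTube C →ₗ[ℂ] Tube C :=
  DirectSum.toModule ℂ (RLabel C) _ fun t =>
    resolve (𝟙_ C) t.b.obj t.c t.e t.f t.h ∘ₗ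
      TensorProduct.map
        (Linear.rightComp ℂ t.c.obj ((λ_ t.e.obj).inv ▷ t.b.obj))
        (Linear.leftComp ℂ t.h.obj ((λ_ t.f.obj).hom ▷ t.b.obj))

/-- The simple summands of the tensor unit. -/
def IsUnitLabel (x : Irr C) : Prop := ∃ f : 𝟙_ C ⟶ x.obj, f ≠ 0

variable (C)

/-- The span of the bulk diagrams with trivial right arc. -/
def leftPart : Submodule ℂ (Tube C) :=
  Submodule.span ℂ {X | ∃ (a b c d e f g h : Irr C) (μ : c.obj ⟶ d.obj ⊗ b.obj)
    (ν : d.obj ⟶ a.obj ⊗ e.obj) (ζ : a.obj ⊗ f.obj ⟶ g.obj) (γ : g.obj ⊗ b.obj ⟶ h.obj),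
    IsUnitLabel b ∧ X = diagram μ ν ζ γ}

/-- The span of the bulk diagrams with trivial left arc. -/
def rightPart : Submodule ℂ (Tube C) :=
  Submodule.span ℂ {X | ∃ (a b c d e f g h : Irr C) (μ : c.obj ⟶ d.obj ⊗ b.obj)
    (ν : d.obj ⟶ a.obj ⊗ e.obj) (ζ : a.obj ⊗ f.obj ⟶ g.obj) (γ : g.obj ⊗ b.obj ⟶ h.obj),
    IsUnitLabel a ∧ X = diagram μ ν ζ γ}

variable {C}

/-- `x` and `y` lie in the same column `⊕ᵢ C_{i,j}` of the canonical grading. -/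
def SameColumn (x y : Irr C) : Prop :=
  ∃ j : Irr C, IsUnitLabel j ∧ ¬ IsZero (x.obj ⊗ j.obj) ∧ ¬ IsZero (y.obj ⊗ j.obj)

/-- `x` and `y` lie in the same row `⊕ⱼ C_{i,j}` of the canonical grading. -/
def SameRow (x y : Irr C) : Prop :=
  ∃ i : Irr C, IsUnitLabel i ∧ ¬ IsZero (i.obj ⊗ x.obj) ∧ ¬ IsZero (i.obj ⊗ y.obj)

variable (C)

/-- The span of the left boundary diagrams whose upper and lower edges lie in different columns. -/
def lMismatch : Submodule ℂ (LTube C) :=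
  Submodule.span ℂ {l | ∃ (a d e f g : Irr C) (ν : d.obj ⟶ a.obj ⊗ e.obj)
    (ζ : a.obj ⊗ f.obj ⟶ g.obj), ¬ SameColumn d g ∧ l = lDiagram ν ζ}

/-- The span of the right boundary diagrams whose upper and lower edges lie in different rows. -/
def rMismatch : Submodule ℂ (RTube C) :=
  Submodule.span ℂ {r | ∃ (b c d g h : Irr C) (μ : c.obj ⟶ d.obj ⊗ b.obj)
    (γ : g.obj ⊗ b.obj ⟶ h.obj), ¬ SameRow c h ∧ r = rDiagram μ γ}

/-! ### The crossed product -/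

/-- The relations of the crossed product: `r ⊗ l` vanishes unless the inner edges of the right
diagram `r` carry the same labels as the outer edges of the left diagram `l`. -/
def gluingRelations : Submodule ℂ (RTube C ⊗[ℂ] LTube C) :=
  Submodule.span ℂ {z | ∃ (t : RLabel C) (s : LLabel C) (x : t.Low ⊗[ℂ] t.Up)
    (y : s.Low ⊗[ℂ] s.Up), (t.e ≠ s.d ∨ t.f ≠ s.g) ∧ z = rOf t x ⊗ₜ[ℂ] lOf s y}

instance : AddCommGroup (RTube C ⊗[ℂ] LTube C) := TensorProduct.addCommGroup

/-- The underlying space of the crossed product of the right and the left boundary tube algebra. -/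
abbrev CrossedProduct : Type _ := (RTube C ⊗[ℂ] LTube C) ⧸ gluingRelations C

variable {C}

/-- The class of `r ⊗ l` in the crossed product. -/
def cross (r : RTube C) (l : LTube C) : CrossedProduct C :=
  (gluingRelations C).mkQ (r ⊗ₜ[ℂ] l)

/-- Lower half of a right diagram `s` put inside a left diagram `t`, rebracketed. -/
def exLow (t : LLabel C) (s : RLabel C) : t.Low →ₗ[ℂ] s.Low →ₗ[ℂ]
    (t.d.obj ⟶ (t.a.obj ⊗ s.e.obj) ⊗ s.b.obj) :=
  LinearMap.mk₂ ℂ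
    (fun p p' => p ≫ t.a.obj ◁ (edge t.e s.c ≫ p') ≫ (α_ _ _ _).inv)
    (by intros; simp) (by intros; simp) (by intros; simp) (by intros; simp)

/-- Upper half of a right diagram `s` put inside a left diagram `t`, rebracketed. -/
def exUp (t : LLabel C) (s : RLabel C) : t.Up →ₗ[ℂ] s.Up →ₗ[ℂ]
    ((t.a.obj ⊗ s.f.obj) ⊗ s.b.obj ⟶ t.g.obj) :=
  LinearMap.mk₂ ℂ
    (fun q q' => (α_ _ _ _).hom ≫ t.a.obj ◁ (q' ≫ edge s.h t.f) ≫ q)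
    (by intros; simp) (by intros; simp) (by intros; simp) (by intros; simp)

/-- F-moves: a diagram with inner left arc `a` and outer right arc `b` is expanded in the tree
bases, and is cut into right diagrams (outside) and left diagrams (inside). -/
def cut (a b d e f g : Irr C) :
    (d.obj ⟶ (a.obj ⊗ e.obj) ⊗ b.obj) ⊗[ℂ] ((a.obj ⊗ f.obj) ⊗ b.obj ⟶ g.obj) →ₗ[ℂ]
      RTube C ⊗[ℂ] LTube C :=
  ∑ m : Fin (decomp (a.obj ⊗ e.obj)).n, ∑ n : Fin (decomp (a.obj ⊗ f.obj)).n,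
    let D := decomp (a.obj ⊗ e.obj)
    let U := decomp (a.obj ⊗ f.obj)
    (TensorProduct.mk ℂ (RTube C) (LTube C)).flip
        (lDiagram (D.incl m) (U.proj n)) ∘ₗ
      rOf ⟨b, d, D.label m, U.label n, g⟩ ∘ₗ
        TensorProduct.map
          (Linear.rightComp ℂ d.obj (D.proj m ▷ b.obj))
          (Linear.leftComp ℂ g.obj (U.incl n ▷ b.obj))

/-- The exchange map: a right diagram inside a left diagram is rewritten by F-moves as a sum of
left diagrams inside right diagrams. -/
def exchange : LTube C →ₗ[ℂ] RTube C →ₗ[ℂ] RTube C ⊗[ℂ] LTube C :=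
  DirectSum.toModule ℂ (LLabel C) _ fun t =>
    (DirectSum.toModule ℂ (RLabel C) _ fun s =>
      ((TensorProduct.map₂ (exLow t s) (exUp t s)).compr₂
        (cut t.a s.b t.d s.e s.f t.g)).flip).flip

/-- `(r ⊗ l) (r' ⊗ l') = ∑ r r'' ⊗ l'' l'`, where `∑ r'' ⊗ l''` is the exchange of `l ⊗ r'`. -/
def preMul : RTube C ⊗[ℂ] LTube C →ₗ[ℂ] RTube C ⊗[ℂ] LTube C →ₗ[ℂ] RTube C ⊗[ℂ] LTube C :=
  TensorProduct.lift
    (LinearMap.mk₂ ℂ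
      (fun r l => TensorProduct.lift
        (LinearMap.mk₂ ℂ
          (fun r' l' => TensorProduct.map (rMul r) (lMul.flip l') (exchange l r'))
          (by intros; simp)
          (by intros; simp)
          (by intros; simp [TensorProduct.map_add_right])
          (by intros; simp [TensorProduct.map_smul_right])))
      (by intros; ext; simp [TensorProduct.map_add_left])
      (by intros; ext; simp [TensorProduct.map_smul_left])
      (by intros; ext; simp)
      (by intros; ext; simp))

/-- The comultiplication `r ⊗ l ↦ ∑ [r₁ ⊗ l₁] ⊗ [r₂ ⊗ l₂]`. -/
def preComul : RTube C ⊗[ℂ] LTube C →ₗ[ℂ] CrossedProduct C ⊗[ℂ] CrossedProduct C :=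
  TensorProduct.map (gluingRelations C).mkQ (gluingRelations C).mkQ ∘ₗ
    (TensorProduct.tensorTensorTensorComm ℂ (RTube C) (RTube C) (LTube C) (LTube C)).toLinearMap ∘ₗ
      TensorProduct.map rComul lComul

theorem map₂_eq_zero {M M' N N' P Q : Type*} [AddCommGroup M] [AddCommGroup M'] [AddCommGroup N]
    [AddCommGroup N'] [AddCommGroup P] [AddCommGroup Q] [Module ℂ M] [Module ℂ M'] [Module ℂ N]
    [Module ℂ N'] [Module ℂ P] [Module ℂ Q] (f : M →ₗ[ℂ] M' →ₗ[ℂ] P) (g : N →ₗ[ℂ] N' →ₗ[ℂ] Q)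
    (h : f = 0 ∨ g = 0) : TensorProduct.map₂ f g = 0 := by
  ext m n m' n'
  rcases h with rfl | rfl <;> simp

theorem rMul_of_ne {t t' : RLabel C} (h : t.e ≠ t'.c ∨ t.f ≠ t'.h) (x : t.Low ⊗[ℂ] t.Up)
    (y : t'.Low ⊗[ℂ] t'.Up) : rMul (rOf t x) (rOf t' y) = 0 := by
  have h0 : TensorProduct.map₂ (rLowStack t t') (rUpStack t t') = 0 := by
    apply map₂_eq_zero
    rcases h with h | h
    · left
      ext p p'
      simp [rLowStack, edge_of_ne h]
    · right
      ext q q'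
      simp [rUpStack, edge_of_ne (Ne.symm h)]
  simp [rMul, rOf, h0]

theorem lMul_of_ne {t t' : LLabel C} (h : t.e ≠ t'.d ∨ t.f ≠ t'.g) (x : t.Low ⊗[ℂ] t.Up)
    (y : t'.Low ⊗[ℂ] t'.Up) : lMul (lOf t x) (lOf t' y) = 0 := by
  have h0 : TensorProduct.map₂ (lLowStack t t') (lUpStack t t') = 0 := by
    apply map₂_eq_zero
    rcases h with h | h
    · left
      ext p p'
      simp [lLowStack, edge_of_ne h]
    · right
      ext q q'
      simp [lUpStack, edge_of_ne (Ne.symm h)]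
  simp [lMul, lOf, h0]

theorem preMul_tmul (r r' : RTube C) (l l' : LTube C) :
    preMul (r ⊗ₜ[ℂ] l) (r' ⊗ₜ[ℂ] l') = TensorProduct.map (rMul r) (lMul.flip l') (exchange l r') :=
  rfl

theorem map_exchange_left {t : RLabel C} {s : LLabel C} (h : t.e ≠ s.d ∨ t.f ≠ s.g)
    (x : t.Low ⊗[ℂ] t.Up) (y : s.Low ⊗[ℂ] s.Up) (w : RLabel C) (z : w.Low ⊗[ℂ] w.Up)
    (l' : LTube C) :
    TensorProduct.map (rMul (rOf t x)) (lMul.flip l') (exchange (lOf s y) (rOf w z)) = 0 := by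
  simp only [exchange, cut, rOf, lOf, DirectSum.toModule_lof, LinearMap.flip_apply,
    LinearMap.compr₂_apply, LinearMap.sum_apply, LinearMap.comp_apply, TensorProduct.mk_apply,
    map_sum, TensorProduct.map_tmul]
  refine Finset.sum_eq_zero fun m _ => Finset.sum_eq_zero fun n _ => ?_
  rw [rMul_of_ne (t' := ⟨_, _, _, _, _⟩) h, TensorProduct.zero_tmul]

theorem map_exchange_right {t : RLabel C} {s : LLabel C} (h : t.e ≠ s.d ∨ t.f ≠ s.g)
    (x : t.Low ⊗[ℂ] t.Up) (y : s.Low ⊗[ℂ] s.Up) (w : LLabel C) (z : w.Low ⊗[ℂ] w.Up)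
    (r : RTube C) :
    TensorProduct.map (rMul r) (lMul.flip (lOf s y)) (exchange (lOf w z) (rOf t x)) = 0 := by
  simp only [exchange, cut, rOf, lOf, DirectSum.toModule_lof, LinearMap.flip_apply,
    LinearMap.compr₂_apply, LinearMap.sum_apply, LinearMap.comp_apply, TensorProduct.mk_apply,
    map_sum, TensorProduct.map_tmul, lDiagram]
  refine Finset.sum_eq_zero fun m _ => Finset.sum_eq_zero fun n _ => ?_
  rw [lMul_of_ne (t := ⟨_, _, _, _, _⟩) h, TensorProduct.tmul_zero]

theorem preMul_left {z : RTube C ⊗[ℂ] LTube C} (hz : z ∈ gluingRelations C) : preMul z = 0 := by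
  have : gluingRelations C ≤ LinearMap.ker (preMul (C := C)) := by
    refine Submodule.span_le.2 ?_
    rintro _ ⟨t, s, x, y, h, rfl⟩
    rw [SetLike.mem_coe, LinearMap.mem_ker]
    refine TensorProduct.ext' fun r' l' => ?_
    rw [preMul_tmul, LinearMap.zero_apply]
    induction r' using DirectSum.induction_on with
    | zero => simp
    | of w z => exact map_exchange_left h x y w z l'
    | add a b ha hb => rw [map_add, map_add, ha, hb, add_zero]
  exact this hz

theorem preMul_right (z : RTube C ⊗[ℂ] LTube C) {z' : RTube C ⊗[ℂ] LTube C}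
    (hz : z' ∈ gluingRelations C) : preMul z z' = 0 := by
  have : gluingRelations C ≤ LinearMap.ker (preMul z) := by
    refine Submodule.span_le.2 ?_
    rintro _ ⟨t, s, x, y, h, rfl⟩
    rw [SetLike.mem_coe, LinearMap.mem_ker]
    induction z using TensorProduct.induction_on with
    | zero => simp
    | add a b ha hb => rw [map_add, LinearMap.add_apply, ha, hb, add_zero]
    | tmul r l =>
      rw [preMul_tmul]
      induction l using DirectSum.induction_on with
      | zero => simp
      | of w z => exact map_exchange_right h x y w z r
      | add a b ha hb => rw [map_add, LinearMap.add_apply, map_add, ha, hb, add_zero]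
  exact this hz

theorem mkQ_of_ne {t : RLabel C} {s : LLabel C} (h : t.e ≠ s.d ∨ t.f ≠ s.g)
    (x : t.Low ⊗[ℂ] t.Up) (y : s.Low ⊗[ℂ] s.Up) :
    (gluingRelations C).mkQ (rOf t x ⊗ₜ[ℂ] lOf s y) = 0 :=
  (Submodule.Quotient.mk_eq_zero _).2 (Submodule.subset_span ⟨t, s, x, y, h, rfl⟩)

theorem tmul_eq_zero_right (x y : CrossedProduct C) (h : y = 0) : x ⊗ₜ[ℂ] y = 0 := by
  rw [h, TensorProduct.tmul_zero]

theorem tmul_eq_zero_left (x y : CrossedProduct C) (h : x = 0) : x ⊗ₜ[ℂ] y = 0 := by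
  rw [h, TensorProduct.zero_tmul]

theorem preComul_relations : gluingRelations C ≤ LinearMap.ker (preComul (C := C)) := by
  refine Submodule.span_le.2 ?_
  rintro _ ⟨t, s, x, y, h, rfl⟩
  rw [SetLike.mem_coe, LinearMap.mem_ker]
  induction x using TensorProduct.induction_on with
  | zero => simp
  | add a b ha hb => rw [map_add, TensorProduct.add_tmul, map_add, ha, hb, add_zero]
  | tmul μ γ =>
  induction y using TensorProduct.induction_on with
  | zero => simp
  | add a b ha hb => rw [map_add, TensorProduct.tmul_add, map_add, ha, hb, add_zero]
  | tmul ν ζ =>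
  simp only [preComul, LinearMap.comp_apply, TensorProduct.map_tmul, rComul, lComul, rOf, lOf,
    DirectSum.toModule_lof, LinearMap.sum_apply, LinearEquiv.coe_coe, TensorProduct.comm_tmul,
    TensorProduct.mk_apply, LinearMap.flip_apply, TensorProduct.sum_tmul, TensorProduct.tmul_sum,
    map_sum, TensorProduct.tensorTensorTensorComm_tmul]
  refine Finset.sum_eq_zero fun _ _ => Finset.sum_eq_zero fun _ _ =>
    Finset.sum_eq_zero fun _ _ => Finset.sum_eq_zero fun _ _ => ?_
  rcases h with h | h
  · refine tmul_eq_zero_right _ _ ?_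
    apply mkQ_of_ne
    exact Or.inl h
  · refine tmul_eq_zero_left _ _ ?_
    apply mkQ_of_ne
    exact Or.inr h

/-- Multiplication of the crossed product. -/
def crossMul : CrossedProduct C →ₗ[ℂ] CrossedProduct C →ₗ[ℂ] CrossedProduct C :=
  (gluingRelations C).liftQ
    ((gluingRelations C).liftQ (preMul.compr₂ (gluingRelations C).mkQ).flip (by
      intro z hz
      refine LinearMap.ext fun w => ?_
      simp [preMul_right w hz])).flip
    (by
      intro z hz
      refine LinearMap.mem_ker.2 (LinearMap.ext fun w => ?_)
      obtain ⟨w, rfl⟩ := (gluingRelations C).mkQ_surjective w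
      change (gluingRelations C).mkQ (preMul z w) = 0
      rw [preMul_left hz, LinearMap.zero_apply, map_zero])

/-- The unit of the crossed product. -/
def crossOne : CrossedProduct C := cross rOne lOne

/-- Comultiplication of the crossed product. -/
def crossComul : CrossedProduct C →ₗ[ℂ] CrossedProduct C ⊗[ℂ] CrossedProduct C :=
  (gluingRelations C).liftQ preComul preComul_relations

end Algebra

/-- The bilinear map `mul` and the element `one` make `A` a unital associative algebra. -/
structure IsAlgebra {A : Type*} [AddCommGroup A] [Module ℂ A] (mul : A →ₗ[ℂ] A →ₗ[ℂ] A)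
    (one : A) : Prop where
  assoc : ∀ x y z, mul (mul x y) z = mul x (mul y z)
  one_mul : ∀ x, mul one x = x
  mul_one : ∀ x, mul x one = x

end TubeAlgebra

end

set_option linter.unusedSectionVars false

noncomputable section

namespace TubeAlgebra

variable {C : Type u} [Category.{v} C] [Abelian C] [Linear ℂ C]
  [MonoidalCategory C] [MonoidalPreadditive C] [MonoidalLinear ℂ C] [RigidCategory C]
  [MultifusionCategory C]

/-! ### Schur's lemma and the dinaturality of dual bases -/

/-! The whole argument rests on one consequence of Schur's lemma. A morphism between chosen simple
objects is zero or a scalar, so it slides across any balanced biadditive expression. Hence a sum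
over dual bases of `Z` is dinatural in `Z` (`SimpleDecomp.sum_comp`), and in particular independent
of the chosen decomposition.

Applied to the arcs, this turns each tube space into a coend. A diagram may carry arbitrary objects
on its arcs (`arc`, `lArc`, `rArc`), and a morphism of arcs may be moved between the lower and the
upper half (`arc_dinatural`). The structure maps then have formulas for arbitrary arcs in which the
fusion sums are gone (`tubeMul_arc`, `tubeComul_arc`, `tubeCounit_arc`). Associativity, the unit
laws and the compatibility of the boundary inclusions with products become instances of monoidal
coherence, after the arcs are compared by an associator or a unitor.

Gluing is defined as `r ⊗ l ↦ ι_R(r) ι_L(l)`. Contracting the trivial arcs shows that it joins the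
two diagrams along their common edges (`glue_arc`). Its inverse cuts a bulk diagram by resolving the
identity of `a ⊗ e` and of `a ⊗ f`: gluing after cutting restores the identity (`glue_cut`), and
cutting after gluing is a Schur collapse (`mkQ_cut`). Multiplicativity is the computation `r l r' l'
= r (∑ r'' l'') l'` in the bulk, since `exchange` expands the bulk product `l r'` (`glue_exchange`).
The crossed product thereby inherits its algebra axioms. For coproducts, dual bases of `(a ⊗ i) ⊗ b`
are compared with those obtained by first splitting `a ⊗ i`.

For the kernels, commutativity of `End(𝟙)` makes the tensor unit multiplicity free. Each summand of
`𝟙` acts on a simple object as the identity or as zero, so adding a trivial right arc kills a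
diagram whose outer edges lie in different columns. On the other diagrams `tubeToL` is a left
inverse. Rows are treated symmetrically with `tubeToR`. -/

@[simp]
theorem edge_self (x : Irr C) : edge x x = 𝟙 x.obj := by
  simp [edge]

theorem hom_eq_zero_of_ne {x y : Irr C} (h : x ≠ y) (f : x.obj ⟶ y.obj) : f = 0 := by
  by_contra hf
  have : Simple x.obj := x.2
  have : Simple y.obj := y.2
  have : IsIso f := isIso_of_hom_simple hf
  apply h
  apply Subtype.ext
  rw [← Quotient.out_eq x.1, ← Quotient.out_eq y.1]
  exact Quotient.sound ⟨@asIso _ _ _ _ f this⟩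

theorem exists_eq_smul_id {x : Irr C} (f : x.obj ⟶ x.obj) : ∃ r : ℂ, f = r • 𝟙 x.obj := by
  have : Simple x.obj := x.2
  have : FiniteDimensional ℂ (x.obj ⟶ x.obj) := MultifusionCategory.finiteDimensional_hom _ _
  obtain ⟨r, hr⟩ := endomorphism_simple_eq_smul_id ℂ f
  exact ⟨r, hr.symm⟩

variable {V : Type*} [AddCommGroup V] [Module ℂ V]

/-- Dual bases are dinatural. -/
theorem SimpleDecomp.sum_comp {Z Z' : C} (D : SimpleDecomp Z) (D' : SimpleDecomp Z') (f : Z ⟶ Z')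
    (Ψ : ∀ x : Irr C, (Z ⟶ x.obj) → (x.obj ⟶ Z') → V)
    (add_left : ∀ x u u' w, Ψ x (u + u') w = Ψ x u w + Ψ x u' w)
    (add_right : ∀ x u w w', Ψ x u (w + w') = Ψ x u w + Ψ x u w')
    (smul : ∀ x (r : ℂ) u w, Ψ x (r • u) w = Ψ x u (r • w)) :
    ∑ i, Ψ (D.label i) (D.proj i) (D.incl i ≫ f) =
      ∑ j, Ψ (D'.label j) (f ≫ D'.proj j) (D'.incl j) := by
  -- This is where Schur's lemma enters: `g` is a scalar when the labels agree and zero otherwise.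
  have slide : ∀ (x y : Irr C) (g : x.obj ⟶ y.obj) (k : Z ⟶ x.obj) (l : y.obj ⟶ Z'),
      Ψ x k (g ≫ l) = Ψ y (k ≫ g) l := by
    intro x y g k l
    by_cases h : x = y
    · subst h
      obtain ⟨r, rfl⟩ := exists_eq_smul_id g
      simp [smul]
    · have hl : Ψ x k 0 = 0 := by simpa using add_right x k 0 0
      have hr : Ψ y 0 l = 0 := by simpa using add_left y 0 0 l
      rw [hom_eq_zero_of_ne h g, zero_comp, comp_zero, hl, hr]
  have sum_left : ∀ (x : Irr C) {n : ℕ} (k : Fin n → (Z ⟶ x.obj)) (l : x.obj ⟶ Z'),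
      Ψ x (∑ i, k i) l = ∑ i, Ψ x (k i) l := fun x n k l =>
    map_sum (AddMonoidHom.mk' (fun k => Ψ x k l) fun _ _ => add_left _ _ _ _) k _
  have sum_right : ∀ (x : Irr C) {n : ℕ} (k : Z ⟶ x.obj) (l : Fin n → (x.obj ⟶ Z')),
      Ψ x k (∑ i, l i) = ∑ i, Ψ x k (l i) := fun x n k l =>
    map_sum (AddMonoidHom.mk' (fun l => Ψ x k l) fun _ _ => add_right _ _ _ _) l _
  -- The identity of `Z'` is inserted through `D'`, the resulting matrix entries of `f` between
  -- simple objects are slid to the left, and the identity of `Z` is then removed.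
  calc ∑ i, Ψ (D.label i) (D.proj i) (D.incl i ≫ f)
      = ∑ i, ∑ j, Ψ (D.label i) (D.proj i) ((D.incl i ≫ f ≫ D'.proj j) ≫ D'.incl j) := by
        refine Finset.sum_congr rfl fun i _ => ?_
        rw [← sum_right]
        congr 1
        simp only [Category.assoc]
        rw [← Preadditive.comp_sum, ← Preadditive.comp_sum, D'.total, Category.comp_id]
    _ = ∑ j, ∑ i, Ψ (D'.label j) (D.proj i ≫ D.incl i ≫ f ≫ D'.proj j) (D'.incl j) := by
        rw [Finset.sum_comm]
        simp only [slide]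
    _ = ∑ j, Ψ (D'.label j) (f ≫ D'.proj j) (D'.incl j) := by
        refine Finset.sum_congr rfl fun j _ => ?_
        rw [← sum_left]
        congr 1
        simp only [← Category.assoc]
        rw [← Preadditive.sum_comp, ← Preadditive.sum_comp, D.total, Category.id_comp]

/-- The trivial decomposition of a simple object. -/
def SimpleDecomp.simple (x : Irr C) : SimpleDecomp x.obj where
  n := 1
  label _ := x
  incl _ := 𝟙 _
  proj _ := 𝟙 _
  incl_proj_self := by simp
  incl_proj_ne i j h := absurd (Subsingleton.elim i j) h
  total := by simp

/-- A simple object is its own one-term dual basis, so dinaturality collapses a sum over dual bases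
to a single term. `sum_to_simple` is the version with the simple object at the target. -/
theorem SimpleDecomp.sum_of_simple {z : Irr C} {Z' : C} (D' : SimpleDecomp Z') (f : z.obj ⟶ Z')
    (Ψ : ∀ x : Irr C, (z.obj ⟶ x.obj) → (x.obj ⟶ Z') → V)
    (add_left : ∀ x u u' w, Ψ x (u + u') w = Ψ x u w + Ψ x u' w)
    (add_right : ∀ x u w w', Ψ x u (w + w') = Ψ x u w + Ψ x u w')
    (smul : ∀ x (r : ℂ) u w, Ψ x (r • u) w = Ψ x u (r • w)) :
    ∑ j, Ψ (D'.label j) (f ≫ D'.proj j) (D'.incl j) = Ψ z (𝟙 _) f := by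
  rw [← SimpleDecomp.sum_comp (SimpleDecomp.simple z) D' f Ψ add_left add_right smul]
  refine (Fin.sum_univ_one _).trans ?_
  simp [SimpleDecomp.simple]

theorem SimpleDecomp.sum_to_simple {z : Irr C} {Z : C} (D : SimpleDecomp Z) (f : Z ⟶ z.obj)
    (Ψ : ∀ x : Irr C, (Z ⟶ x.obj) → (x.obj ⟶ z.obj) → V)
    (add_left : ∀ x u u' w, Ψ x (u + u') w = Ψ x u w + Ψ x u' w)
    (add_right : ∀ x u w w', Ψ x u (w + w') = Ψ x u w + Ψ x u w')
    (smul : ∀ x (r : ℂ) u w, Ψ x (r • u) w = Ψ x u (r • w)) :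
    ∑ i, Ψ (D.label i) (D.proj i) (D.incl i ≫ f) = Ψ z f (𝟙 _) := by
  rw [SimpleDecomp.sum_comp D (SimpleDecomp.simple z) f Ψ add_left add_right smul]
  refine (Fin.sum_univ_one _).trans ?_
  simp [SimpleDecomp.simple]

/-! ### Generators -/

theorem Tube.induction {P : Tube C → Prop} (zero : P 0) (add : ∀ x y, P x → P y → P (x + y))
    (of : ∀ (t : TubeLabel C) (p : t.Low) (q : t.Up), P (tubeOf t (p ⊗ₜ[ℂ] q))) (x : Tube C) :
    P x := by
  induction x using DirectSum.induction_on with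
  | zero => exact zero
  | add x y hx hy => exact add x y hx hy
  | of t z =>
    induction z using TensorProduct.induction_on with
    | zero => simpa using zero
    | tmul p q => exact of t p q
    | add z w hz hw => rw [map_add]; exact add _ _ hz hw

theorem LTube.induction {P : LTube C → Prop} (zero : P 0) (add : ∀ x y, P x → P y → P (x + y))
    (of : ∀ (t : LLabel C) (p : t.Low) (q : t.Up), P (lOf t (p ⊗ₜ[ℂ] q))) (x : LTube C) :
    P x := by
  induction x using DirectSum.induction_on with
  | zero => exact zero
  | add x y hx hy => exact add x y hx hy
  | of t z =>
    induction z using TensorProduct.induction_on with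
    | zero => simpa using zero
    | tmul p q => exact of t p q
    | add z w hz hw => rw [map_add]; exact add _ _ hz hw

theorem RTube.induction {P : RTube C → Prop} (zero : P 0) (add : ∀ x y, P x → P y → P (x + y))
    (of : ∀ (t : RLabel C) (p : t.Low) (q : t.Up), P (rOf t (p ⊗ₜ[ℂ] q))) (x : RTube C) :
    P x := by
  induction x using DirectSum.induction_on with
  | zero => exact zero
  | add x y hx hy => exact add x y hx hy
  | of t z =>
    induction z using TensorProduct.induction_on with
    | zero => simpa using zero
    | tmul p q => exact of t p q
    | add z w hz hw => rw [map_add]; exact add _ _ hz hw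

/-! ### Diagrams whose arcs carry arbitrary objects -/

section Arc

variable {A A' B B' : C} {a b c d e f g h : Irr C}

/-- The bulk diagram with arcs `A` and `B` and halves `p` and `q`. -/
def arc (A B : C) {c e f h : Irr C} (p : c.obj ⟶ (A ⊗ e.obj) ⊗ B) (q : (A ⊗ f.obj) ⊗ B ⟶ h.obj) :
    Tube C :=
  resolve A B c e f h (p ⊗ₜ[ℂ] q)

/-- The left boundary diagram with arc `A` and halves `p` and `q`. -/
def lArc (A : C) {d e f g : Irr C} (p : d.obj ⟶ A ⊗ e.obj) (q : A ⊗ f.obj ⟶ g.obj) : LTube C :=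
  lResolve A d e f g (p ⊗ₜ[ℂ] q)

/-- The right boundary diagram with arc `B` and halves `p` and `q`. -/
def rArc (B : C) {c e f h : Irr C} (p : c.obj ⟶ e.obj ⊗ B) (q : f.obj ⊗ B ⟶ h.obj) : RTube C :=
  rResolve B c e f h (p ⊗ₜ[ℂ] q)

theorem arc_eq_sum (p : c.obj ⟶ (A ⊗ e.obj) ⊗ B) (q : (A ⊗ f.obj) ⊗ B ⟶ h.obj) :
    arc A B p q = ∑ i, ∑ j, tubeOf ⟨(decomp A).label i, (decomp B).label j, c, e, f, h⟩
      ((p ≫ (((decomp A).proj i ▷ e.obj) ⊗ₘ (decomp B).proj j)) ⊗ₜ[ℂ]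
        ((((decomp A).incl i ▷ f.obj) ⊗ₘ (decomp B).incl j) ≫ q)) := by
  simp [arc, resolve]

theorem lArc_eq_sum (p : d.obj ⟶ A ⊗ e.obj) (q : A ⊗ f.obj ⟶ g.obj) :
    lArc A p q = ∑ i, lOf ⟨(decomp A).label i, d, e, f, g⟩
      ((p ≫ (decomp A).proj i ▷ e.obj) ⊗ₜ[ℂ] ((decomp A).incl i ▷ f.obj ≫ q)) := by
  simp [lArc, lResolve]

theorem rArc_eq_sum (p : c.obj ⟶ e.obj ⊗ B) (q : f.obj ⊗ B ⟶ h.obj) :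
    rArc B p q = ∑ j, rOf ⟨(decomp B).label j, c, e, f, h⟩
      ((p ≫ e.obj ◁ (decomp B).proj j) ⊗ₜ[ℂ] (f.obj ◁ (decomp B).incl j ≫ q)) := by
  simp [rArc, rResolve]

theorem arc_sum {ι : Type*} (s : Finset ι) (p : c.obj ⟶ (A ⊗ e.obj) ⊗ B)
    (q : ι → ((A ⊗ f.obj) ⊗ B ⟶ h.obj)) :
    arc A B p (∑ i ∈ s, q i) = ∑ i ∈ s, arc A B p (q i) := by
  simp [arc, TensorProduct.tmul_sum]

theorem lArc_sum {ι : Type*} (s : Finset ι) (p : d.obj ⟶ A ⊗ e.obj)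
    (q : ι → (A ⊗ f.obj ⟶ g.obj)) :
    lArc A p (∑ i ∈ s, q i) = ∑ i ∈ s, lArc A p (q i) := by
  simp [lArc, TensorProduct.tmul_sum]

theorem rArc_sum {ι : Type*} (s : Finset ι) (p : c.obj ⟶ e.obj ⊗ B)
    (q : ι → (f.obj ⊗ B ⟶ h.obj)) :
    rArc B p (∑ i ∈ s, q i) = ∑ i ∈ s, rArc B p (q i) := by
  simp [rArc, TensorProduct.tmul_sum]

/-- Dinaturality of dual bases, used once for each arc. It makes the tube algebra a coend over its
arcs and is the tool behind all comparisons of diagrams below. -/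
theorem arc_dinatural (k : A ⟶ A') (l : B ⟶ B') (p : c.obj ⟶ (A ⊗ e.obj) ⊗ B)
    (q : (A' ⊗ f.obj) ⊗ B' ⟶ h.obj) :
    arc A' B' (p ≫ ((k ▷ e.obj) ⊗ₘ l)) q = arc A B p (((k ▷ f.obj) ⊗ₘ l) ≫ q) := by
  -- The right arc is treated first, with the data of the left arc frozen as arbitrary `m` and `n`,
  -- so that the result can be applied inside the sum over the left arc.
  have step : ∀ (x : Irr C) (m : A ⟶ x.obj) (n : x.obj ⟶ A'),
      ∑ j, tubeOf ⟨x, (decomp B).label j, c, e, f, h⟩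
        ((p ≫ (m ▷ e.obj ⊗ₘ (decomp B).proj j)) ⊗ₜ[ℂ]
          ((n ▷ f.obj ⊗ₘ ((decomp B).incl j ≫ l)) ≫ q)) =
      ∑ j, tubeOf ⟨x, (decomp B').label j, c, e, f, h⟩
        ((p ≫ (m ▷ e.obj ⊗ₘ (l ≫ (decomp B').proj j))) ⊗ₜ[ℂ]
          ((n ▷ f.obj ⊗ₘ (decomp B').incl j) ≫ q)) := by
    intro x m n
    refine SimpleDecomp.sum_comp (decomp B) (decomp B') l
      (fun y u w => tubeOf ⟨x, y, c, e, f, h⟩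
        ((p ≫ (m ▷ e.obj ⊗ₘ u)) ⊗ₜ[ℂ] ((n ▷ f.obj ⊗ₘ w) ≫ q))) ?_ ?_ ?_ <;> intros <;>
      simp [MonoidalCategory.tensorHom_def, TensorProduct.add_tmul, TensorProduct.tmul_add, TensorProduct.smul_tmul]
  have := SimpleDecomp.sum_comp (decomp A) (decomp A') k
    (fun x u w => ∑ j, tubeOf ⟨x, (decomp B).label j, c, e, f, h⟩
        ((p ≫ (u ▷ e.obj ⊗ₘ (decomp B).proj j)) ⊗ₜ[ℂ]
          ((w ▷ f.obj ⊗ₘ ((decomp B).incl j ≫ l)) ≫ q)))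
      (by intros; simp [MonoidalCategory.tensorHom_def, TensorProduct.add_tmul, Finset.sum_add_distrib])
      (by intros; simp [MonoidalCategory.tensorHom_def, TensorProduct.tmul_add, Finset.sum_add_distrib])
      (by intros; simp [MonoidalCategory.tensorHom_def, TensorProduct.smul_tmul])
  rw [arc_eq_sum, arc_eq_sum]
  simp only [step] at this
  simp only [step, Category.assoc, tensorHom_comp_tensorHom, tensorHom_comp_tensorHom_assoc,
    ← comp_whiskerRight] 
  exact this.symm

theorem lArc_dinatural (k : A ⟶ A') (p : d.obj ⟶ A ⊗ e.obj) (q : A' ⊗ f.obj ⟶ g.obj) :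
    lArc A' (p ≫ k ▷ e.obj) q = lArc A p (k ▷ f.obj ≫ q) := by
  have := SimpleDecomp.sum_comp (decomp A) (decomp A') k
    (fun x u w => lOf ⟨x, d, e, f, g⟩ ((p ≫ u ▷ e.obj) ⊗ₜ[ℂ] (w ▷ f.obj ≫ q)))
      (by intros; simp [TensorProduct.add_tmul])
      (by intros; simp [TensorProduct.tmul_add])
      (by intros; simp [TensorProduct.smul_tmul])
  rw [lArc_eq_sum, lArc_eq_sum]
  simpa only [Category.assoc, comp_whiskerRight] using this.symm

theorem rArc_dinatural (k : B ⟶ B') (p : c.obj ⟶ e.obj ⊗ B) (q : f.obj ⊗ B' ⟶ h.obj) :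
    rArc B' (p ≫ e.obj ◁ k) q = rArc B p (f.obj ◁ k ≫ q) := by
  have := SimpleDecomp.sum_comp (decomp B) (decomp B') k
    (fun x u w => rOf ⟨x, c, e, f, h⟩ ((p ≫ e.obj ◁ u) ⊗ₜ[ℂ] (f.obj ◁ w ≫ q)))
      (by intros; simp [TensorProduct.add_tmul])
      (by intros; simp [TensorProduct.tmul_add])
      (by intros; simp [TensorProduct.smul_tmul])
  rw [rArc_eq_sum, rArc_eq_sum]
  simpa only [Category.assoc, MonoidalCategory.whiskerLeft_comp] using this.symm

/-- Resolving an arc that is already simple changes nothing, by the Schur collapse on each arc.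
Generators are thus special cases of diagrams with arbitrary arcs. -/
theorem arc_simple (p : c.obj ⟶ (a.obj ⊗ e.obj) ⊗ b.obj) (q : (a.obj ⊗ f.obj) ⊗ b.obj ⟶ h.obj) :
    arc a.obj b.obj p q = tubeOf ⟨a, b, c, e, f, h⟩ (p ⊗ₜ[ℂ] q) := by
  have step : ∀ (x : Irr C) (m : a.obj ⟶ x.obj) (n : x.obj ⟶ a.obj),
      ∑ j, tubeOf ⟨x, (decomp b.obj).label j, c, e, f, h⟩
        ((p ≫ (m ▷ e.obj ⊗ₘ (𝟙 _ ≫ (decomp b.obj).proj j))) ⊗ₜ[ℂ]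
          ((n ▷ f.obj ⊗ₘ (decomp b.obj).incl j) ≫ q)) =
      tubeOf ⟨x, b, c, e, f, h⟩
        ((p ≫ (m ▷ e.obj ⊗ₘ 𝟙 _)) ⊗ₜ[ℂ] ((n ▷ f.obj ⊗ₘ 𝟙 _) ≫ q)) := by
    intro x m n
    refine SimpleDecomp.sum_of_simple (decomp b.obj) (𝟙 _)
      (fun y u w => tubeOf ⟨x, y, c, e, f, h⟩
        ((p ≫ (m ▷ e.obj ⊗ₘ u)) ⊗ₜ[ℂ] ((n ▷ f.obj ⊗ₘ w) ≫ q))) ?_ ?_ ?_ <;> intros <;>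
      simp [MonoidalCategory.tensorHom_def, TensorProduct.add_tmul, TensorProduct.tmul_add,
        TensorProduct.smul_tmul]
  have := SimpleDecomp.sum_of_simple (decomp a.obj) (𝟙 _)
    (fun x u w => tubeOf ⟨x, b, c, e, f, h⟩
        ((p ≫ (u ▷ e.obj ⊗ₘ 𝟙 _)) ⊗ₜ[ℂ] ((w ▷ f.obj ⊗ₘ 𝟙 _) ≫ q)))
      (by intros; simp [TensorProduct.add_tmul])
      (by intros; simp [TensorProduct.tmul_add])
      (by intros; simp [TensorProduct.smul_tmul])
  rw [arc_eq_sum]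
  simp only [Category.id_comp] at step this
  simp only [step, this]
  simp

theorem lArc_simple (p : d.obj ⟶ a.obj ⊗ e.obj) (q : a.obj ⊗ f.obj ⟶ g.obj) :
    lArc a.obj p q = lOf ⟨a, d, e, f, g⟩ (p ⊗ₜ[ℂ] q) := by
  have := SimpleDecomp.sum_of_simple (decomp a.obj) (𝟙 _)
    (fun x u w => lOf ⟨x, d, e, f, g⟩ ((p ≫ u ▷ e.obj) ⊗ₜ[ℂ] (w ▷ f.obj ≫ q)))
      (by intros; simp [TensorProduct.add_tmul])
      (by intros; simp [TensorProduct.tmul_add])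
      (by intros; simp [TensorProduct.smul_tmul])
  rw [lArc_eq_sum]
  simp only [Category.id_comp] at this
  simp [this]

theorem rArc_simple (p : c.obj ⟶ e.obj ⊗ b.obj) (q : f.obj ⊗ b.obj ⟶ h.obj) :
    rArc b.obj p q = rOf ⟨b, c, e, f, h⟩ (p ⊗ₜ[ℂ] q) := by
  have := SimpleDecomp.sum_of_simple (decomp b.obj) (𝟙 _)
    (fun x u w => rOf ⟨x, c, e, f, h⟩ ((p ≫ e.obj ◁ u) ⊗ₜ[ℂ] (f.obj ◁ w ≫ q)))
      (by intros; simp [TensorProduct.add_tmul])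
      (by intros; simp [TensorProduct.tmul_add])
      (by intros; simp [TensorProduct.smul_tmul])
  rw [rArc_eq_sum]
  simp only [Category.id_comp] at this
  simp [this]

end Arc

/-! ### Products of diagrams with arbitrary arcs -/

section Mul

variable {A A' B B' : C} {a b c d e f g h a' b' c' d' e' f' g' h' : Irr C}

theorem nest_hom (A A' x B' B : C) : (nest A A' x B' B).hom =
    ((α_ A (A' ⊗ x) B').inv ≫ (α_ A A' x).inv ▷ B') ▷ B ≫ (α_ ((A ⊗ A') ⊗ x) B' B).hom := rfl

theorem nest_inv (A A' x B' B : C) : (nest A A' x B' B).inv =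
    (α_ ((A ⊗ A') ⊗ x) B' B).inv ≫ ((α_ A A' x).hom ▷ B' ≫ (α_ A (A' ⊗ x) B').hom) ▷ B := rfl

theorem nest_naturality_arcs {A₁ A₂ A₁' A₂' B₁ B₂ B₁' B₂' x y : C} (k : A₁ ⟶ A₂) (k' : A₁' ⟶ A₂')
    (l' : B₁' ⟶ B₂') (l : B₁ ⟶ B₂) (m : x ⟶ y) :
    ((k ⊗ₘ ((k' ⊗ₘ m) ⊗ₘ l')) ⊗ₘ l) ≫ (nest A₂ A₂' y B₂' B₂).hom =
      (nest A₁ A₁' x B₁' B₁).hom ≫ (((k ⊗ₘ k') ⊗ₘ m) ⊗ₘ (l' ⊗ₘ l)) := by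
  simp only [nest_hom, ← tensorHom_id,
    tensorHom_comp_tensorHom_assoc, tensorHom_comp_tensorHom, Category.assoc, Category.comp_id,
    ← associator_naturality, associator_inv_naturality, associator_inv_naturality_assoc,
    Category.id_comp]

/-- The product of generators first resolves each arc and then fuses. By naturality the projections
move to the end of the lower half and the inclusions to the start of the upper half. Dinaturality
brings them together, and their sums are identities. The right and the bulk products follow the same
pattern. -/
theorem lMul_lArc (p : d.obj ⟶ A ⊗ e.obj) (q : A ⊗ f.obj ⟶ g.obj) (p' : d'.obj ⟶ A' ⊗ e'.obj)
    (q' : A' ⊗ f'.obj ⟶ g'.obj) :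
    lMul (lArc A p q) (lArc A' p' q') =
      lArc (A ⊗ A') (p ≫ A ◁ (edge e d' ≫ p') ≫ (α_ _ _ _).inv)
        ((α_ _ _ _).hom ≫ A ◁ (q' ≫ edge g' f) ≫ q) := by
  have of : ∀ (t t' : LLabel C) (p : t.Low) (q : t.Up) (p' : t'.Low) (q' : t'.Up),
      lMul (lOf t (p ⊗ₜ[ℂ] q)) (lOf t' (p' ⊗ₜ[ℂ] q')) =
        lArc (t.a.obj ⊗ t'.a.obj) (p ≫ t.a.obj ◁ (edge t.e t'.d ≫ p') ≫ (α_ _ _ _).inv)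
        ((α_ _ _ _).hom ≫ t.a.obj ◁ (q' ≫ edge t'.g t.f) ≫ q) := by
    intro t t' p q p' q'
    simp [lMul, lArc, lLowStack, lUpStack]
  have low : ∀ i k,
      ((p ≫ (decomp A).proj i ▷ e.obj) ≫ ((decomp A).label i).obj ◁ (edge e d' ≫
        p' ≫ (decomp A').proj k ▷ e'.obj) ≫ (α_ _ _ _).inv) =
      (p ≫ A ◁ (edge e d' ≫ p') ≫ (α_ _ _ _).inv) ≫
        ((decomp A).proj i ⊗ₘ (decomp A').proj k) ▷ e'.obj := by
    intro i k
    simp only [← id_tensorHom, ← tensorHom_id, tensorHom_comp_tensorHom_assoc,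
      Category.assoc, Category.id_comp, Category.comp_id, ← associator_inv_naturality]
  have up : ∀ i k,
      ((decomp A).incl i ⊗ₘ (decomp A').incl k) ▷ f'.obj ≫
        (α_ _ _ _).hom ≫ A ◁ (q' ≫ edge g' f) ≫ q =
      (α_ _ _ _).hom ≫ ((decomp A).label i).obj ◁ (((decomp A').incl k ▷ f'.obj ≫ q') ≫ edge g' f) ≫
        (decomp A).incl i ▷ f.obj ≫ q := by
    intro i k
    simp only [← id_tensorHom, ← tensorHom_id, tensorHom_comp_tensorHom_assoc,
      Category.assoc, Category.id_comp, Category.comp_id, associator_naturality_assoc]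
  rw [lArc_eq_sum, lArc_eq_sum]
  simp only [map_sum, LinearMap.sum_apply, of]
  simp only [low, ← up, lArc_dinatural, ← lArc_sum, ← comp_whiskerRight_assoc,
    tensorHom_comp_tensorHom, ← Preadditive.sum_comp, ← sum_whiskerRight,
    ← tensor_sum, ← sum_tensor, SimpleDecomp.total]
  simp

theorem rMul_rArc (p : c.obj ⟶ e.obj ⊗ B) (q : f.obj ⊗ B ⟶ h.obj) (p' : c'.obj ⟶ e'.obj ⊗ B')
    (q' : f'.obj ⊗ B' ⟶ h'.obj) :
    rMul (rArc B p q) (rArc B' p' q') =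
      rArc (B' ⊗ B) (p ≫ (edge e c' ≫ p') ▷ B ≫ (α_ _ _ _).hom)
        ((α_ _ _ _).inv ≫ (q' ≫ edge h' f) ▷ B ≫ q) := by
  have of : ∀ (t t' : RLabel C) (p : t.Low) (q : t.Up) (p' : t'.Low) (q' : t'.Up),
      rMul (rOf t (p ⊗ₜ[ℂ] q)) (rOf t' (p' ⊗ₜ[ℂ] q')) =
        rArc (t'.b.obj ⊗ t.b.obj) (p ≫ (edge t.e t'.c ≫ p') ▷ t.b.obj ≫ (α_ _ _ _).hom)
        ((α_ _ _ _).inv ≫ (q' ≫ edge t'.h t.f) ▷ t.b.obj ≫ q) := by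
    intro t t' p q p' q'
    simp [rMul, rArc, rLowStack, rUpStack]
  have low : ∀ i k,
      ((p ≫ e.obj ◁ (decomp B).proj i) ≫ (edge e c' ≫
        p' ≫ e'.obj ◁ (decomp B').proj k) ▷ ((decomp B).label i).obj ≫ (α_ _ _ _).hom) =
      (p ≫ (edge e c' ≫ p') ▷ B ≫ (α_ _ _ _).hom) ≫
        e'.obj ◁ ((decomp B').proj k ⊗ₘ (decomp B).proj i) := by
    intro i k
    simp only [← id_tensorHom, ← tensorHom_id, tensorHom_comp_tensorHom_assoc,
      Category.assoc, Category.id_comp, Category.comp_id, ← associator_naturality]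
  have up : ∀ i k,
      f'.obj ◁ ((decomp B').incl k ⊗ₘ (decomp B).incl i) ≫
        (α_ _ _ _).inv ≫ (q' ≫ edge h' f) ▷ B ≫ q =
      (α_ _ _ _).inv ≫ ((f'.obj ◁ (decomp B').incl k ≫ q') ≫ edge h' f) ▷ ((decomp B).label i).obj ≫
        f.obj ◁ (decomp B).incl i ≫ q := by
    intro i k
    simp only [← id_tensorHom, ← tensorHom_id, tensorHom_comp_tensorHom_assoc,
      Category.assoc, Category.id_comp, Category.comp_id, associator_inv_naturality_assoc]
  rw [rArc_eq_sum, rArc_eq_sum]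
  simp only [map_sum, LinearMap.sum_apply, of]
  simp only [low, ← up, rArc_dinatural, ← rArc_sum, ← MonoidalCategory.whiskerLeft_comp_assoc,
    tensorHom_comp_tensorHom, ← Preadditive.sum_comp, ← whiskerLeft_sum,
    ← tensor_sum, ← sum_tensor, SimpleDecomp.total]
  simp

theorem tubeMul_arc (p : c.obj ⟶ (A ⊗ e.obj) ⊗ B) (q : (A ⊗ f.obj) ⊗ B ⟶ h.obj)
    (p' : c'.obj ⟶ (A' ⊗ e'.obj) ⊗ B') (q' : (A' ⊗ f'.obj) ⊗ B' ⟶ h'.obj) :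
    tubeMul (arc A B p q) (arc A' B' p' q') =
      arc (A ⊗ A') (B' ⊗ B) (p ≫ (A ◁ (edge e c' ≫ p')) ▷ B ≫ (nest _ _ _ _ _).hom)
        ((nest _ _ _ _ _).inv ≫ (A ◁ (q' ≫ edge h' f)) ▷ B ≫ q) := by
  have of : ∀ (t t' : TubeLabel C) (p : t.Low) (q : t.Up) (p' : t'.Low) (q' : t'.Up),
      tubeMul (tubeOf t (p ⊗ₜ[ℂ] q)) (tubeOf t' (p' ⊗ₜ[ℂ] q')) =
        arc (t.a.obj ⊗ t'.a.obj) (t'.b.obj ⊗ t.b.obj)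
        (p ≫ (t.a.obj ◁ (edge t.e t'.c ≫ p')) ▷ t.b.obj ≫ (nest _ _ _ _ _).hom)
        ((nest _ _ _ _ _).inv ≫ (t.a.obj ◁ (q' ≫ edge t'.h t.f)) ▷ t.b.obj ≫ q) := by
    intro t t' p q p' q'
    simp [tubeMul, arc, lowStack, upStack]
  have low : ∀ i j k l,
      (p ≫ ((decomp A).proj i ▷ e.obj ⊗ₘ (decomp B).proj j)) ≫
        (((decomp A).label i).obj ◁ (edge e c' ≫
          p' ≫ ((decomp A').proj k ▷ e'.obj ⊗ₘ (decomp B').proj l))) ▷ ((decomp B).label j).obj ≫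
            (nest _ _ _ _ _).hom =
      (p ≫ (A ◁ (edge e c' ≫ p')) ▷ B ≫ (nest _ _ _ _ _).hom) ≫
        (((decomp A).proj i ⊗ₘ (decomp A').proj k) ▷ e'.obj ⊗ₘ
          ((decomp B').proj l ⊗ₘ (decomp B).proj j)) := by
    intro i j k l
    simp only [← id_tensorHom, ← tensorHom_id, tensorHom_comp_tensorHom_assoc,
      tensorHom_comp_tensorHom, Category.assoc, Category.id_comp, Category.comp_id, ← nest_naturality_arcs]
  have up : ∀ i j k l,
      (((decomp A).incl i ⊗ₘ (decomp A').incl k) ▷ f'.obj ⊗ₘ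
          ((decomp B').incl l ⊗ₘ (decomp B).incl j)) ≫
      ((nest _ _ _ _ _).inv ≫ (A ◁ (q' ≫ edge h' f)) ▷ B ≫ q) =
      (nest _ _ _ _ _).inv ≫ (((decomp A).label i).obj ◁
        ((((decomp A').incl k ▷ f'.obj ⊗ₘ (decomp B').incl l) ≫ q') ≫ edge h' f)) ▷
          ((decomp B).label j).obj ≫
        ((decomp A).incl i ▷ f.obj ⊗ₘ (decomp B).incl j) ≫ q := by
    intro i j k l
    -- Naturality of `nest` is available for its forward direction only, so the inverse is cancelled
    -- first.
    rw [← cancel_epi (nest _ _ _ _ _).hom, ← tensorHom_id, ← reassoc_of% nest_naturality_arcs]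
    simp only [← id_tensorHom, ← tensorHom_id, tensorHom_comp_tensorHom_assoc,
      tensorHom_comp_tensorHom, Category.assoc, Category.id_comp, Category.comp_id,
      Iso.hom_inv_id_assoc]
  rw [arc_eq_sum, arc_eq_sum]
  simp only [map_sum, LinearMap.sum_apply, of]
  simp only [low, ← up, arc_dinatural, ← arc_sum, ← comp_whiskerRight,
    tensorHom_comp_tensorHom, tensorHom_comp_tensorHom_assoc, ← Preadditive.sum_comp,
    ← sum_whiskerRight, ← tensor_sum, ← sum_tensor, SimpleDecomp.total]
  simp

end Mul

/-! ### Associativity and unit laws of the three tube algebras -/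

section Algebras

variable {A A' B B' : C} {a b c d e f g h a' b' c' d' e' f' g' h' : Irr C}

/-- The working form of dinaturality: any morphism of arcs compatible with both halves identifies
two diagrams. Invertibility of `k` and `l` is not needed. -/
theorem arc_congr (k : A ⟶ A') (l : B ⟶ B') {p : c.obj ⟶ (A ⊗ e.obj) ⊗ B}
    {q : (A ⊗ f.obj) ⊗ B ⟶ h.obj} {p' : c.obj ⟶ (A' ⊗ e.obj) ⊗ B'}
    {q' : (A' ⊗ f.obj) ⊗ B' ⟶ h.obj} (low : p ≫ ((k ▷ e.obj) ⊗ₘ l) = p')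
    (up : ((k ▷ f.obj) ⊗ₘ l) ≫ q' = q) : arc A B p q = arc A' B' p' q' := by
  rw [← low, ← up, arc_dinatural]

theorem lArc_congr (k : A ⟶ A') {p : d.obj ⟶ A ⊗ e.obj} {q : A ⊗ f.obj ⟶ g.obj}
    {p' : d.obj ⟶ A' ⊗ e.obj} {q' : A' ⊗ f.obj ⟶ g.obj} (low : p ≫ k ▷ e.obj = p')
    (up : k ▷ f.obj ≫ q' = q) : lArc A p q = lArc A' p' q' := by
  rw [← low, ← up, lArc_dinatural]

theorem rArc_congr (k : B ⟶ B') {p : c.obj ⟶ e.obj ⊗ B} {q : f.obj ⊗ B ⟶ h.obj}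
    {p' : c.obj ⟶ e.obj ⊗ B'} {q' : f.obj ⊗ B' ⟶ h.obj} (low : p ≫ e.obj ◁ k = p')
    (up : f.obj ◁ k ≫ q' = q) : rArc B p q = rArc B' p' q' := by
  rw [← low, ← up, rArc_dinatural]

@[simp]
theorem arc_zero_left (q : (A ⊗ f.obj) ⊗ B ⟶ h.obj) :
    arc A B (0 : c.obj ⟶ (A ⊗ e.obj) ⊗ B) q = 0 := by
  simp [arc]

@[simp]
theorem arc_zero_right (p : c.obj ⟶ (A ⊗ e.obj) ⊗ B) :
    arc A B p (0 : (A ⊗ f.obj) ⊗ B ⟶ h.obj) = 0 := by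
  simp [arc]

@[simp]
theorem lArc_zero_left (q : A ⊗ f.obj ⟶ g.obj) : lArc A (0 : d.obj ⟶ A ⊗ e.obj) q = 0 := by
  simp [lArc]

@[simp]
theorem lArc_zero_right (p : d.obj ⟶ A ⊗ e.obj) : lArc A p (0 : A ⊗ f.obj ⟶ g.obj) = 0 := by
  simp [lArc]

@[simp]
theorem rArc_zero_left (q : f.obj ⊗ B ⟶ h.obj) : rArc B (0 : c.obj ⟶ e.obj ⊗ B) q = 0 := by
  simp [rArc]

@[simp]
theorem rArc_zero_right (p : c.obj ⟶ e.obj ⊗ B) : rArc B p (0 : f.obj ⊗ B ⟶ h.obj) = 0 := by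
  simp [rArc]

theorem sum_sum_eq_of_ne {V : Type*} [AddCommMonoid V] (F : Irr C → Irr C → V) (x y : Irr C)
    (hF : ∀ x' y', x' ≠ x ∨ y' ≠ y → F x' y' = 0) : ∑ x', ∑ y', F x' y' = F x y := by
  rw [Finset.sum_eq_single x (fun x' _ hx => Finset.sum_eq_zero fun y' _ => hF _ _ (Or.inl hx))
    (fun hx => absurd (Finset.mem_univ _) hx)]
  exact Finset.sum_eq_single y (fun y' _ hy => hF _ _ (Or.inr hy))
    (fun hx => absurd (Finset.mem_univ _) hx)

theorem tubeOne_eq : tubeOne (C := C) = ∑ c : Irr C, ∑ h : Irr C,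
    arc (𝟙_ C) (𝟙_ C) ((λ_ c.obj).inv ≫ (ρ_ (𝟙_ C ⊗ c.obj)).inv)
      ((ρ_ (𝟙_ C ⊗ h.obj)).hom ≫ (λ_ h.obj).hom) := rfl

theorem lOne_eq : lOne (C := C) = ∑ d : Irr C, ∑ g : Irr C,
    lArc (𝟙_ C) (λ_ d.obj).inv (λ_ g.obj).hom := rfl

theorem rOne_eq : rOne (C := C) = ∑ c : Irr C, ∑ h : Irr C,
    rArc (𝟙_ C) (ρ_ c.obj).inv (ρ_ h.obj).hom := rfl

theorem Tube.arc_induction {P : Tube C → Prop} (zero : P 0) (add : ∀ x y, P x → P y → P (x + y))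
    (of : ∀ (a b c e f h : Irr C) (p : c.obj ⟶ (a.obj ⊗ e.obj) ⊗ b.obj)
      (q : (a.obj ⊗ f.obj) ⊗ b.obj ⟶ h.obj), P (arc a.obj b.obj p q)) (x : Tube C) : P x :=
  Tube.induction zero add (fun t p q => arc_simple p q ▸ of t.a t.b t.c t.e t.f t.h p q) x

theorem LTube.arc_induction {P : LTube C → Prop} (zero : P 0)
    (add : ∀ x y, P x → P y → P (x + y))
    (of : ∀ (a d e f g : Irr C) (p : d.obj ⟶ a.obj ⊗ e.obj) (q : a.obj ⊗ f.obj ⟶ g.obj),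
      P (lArc a.obj p q)) (x : LTube C) : P x :=
  LTube.induction zero add (fun t p q => lArc_simple p q ▸ of t.a t.d t.e t.f t.g p q) x

theorem RTube.arc_induction {P : RTube C → Prop} (zero : P 0)
    (add : ∀ x y, P x → P y → P (x + y))
    (of : ∀ (b c e f h : Irr C) (p : c.obj ⟶ e.obj ⊗ b.obj) (q : f.obj ⊗ b.obj ⟶ h.obj),
      P (rArc b.obj p q)) (x : RTube C) : P x :=
  RTube.induction zero add (fun t p q => rArc_simple p q ▸ of t.b t.c t.e t.f t.h p q) x

theorem isAlgebra_tube : IsAlgebra (tubeMul (C := C)) tubeOne where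
  assoc x y z := by
    induction x using Tube.arc_induction with
    | zero => simp
    | add x₁ x₂ h₁ h₂ => simp only [map_add, LinearMap.add_apply, h₁, h₂]
    | of a b c e f h p q =>
    induction y using Tube.arc_induction with
    | zero => simp
    | add x₁ x₂ h₁ h₂ => simp only [map_add, LinearMap.add_apply, h₁, h₂]
    | of a' b' c' e' f' h' p' q' =>
    induction z using Tube.arc_induction with
    | zero => simp
    | add x₁ x₂ h₁ h₂ => simp only [map_add, h₁, h₂]
    | of a'' b'' c'' e'' f'' h'' p'' q'' =>
    simp only [tubeMul_arc]
    -- Left arcs multiply in the order of the factors and right arcs in the opposite order, hence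
    -- opposite associators on the two sides.
    refine arc_congr (α_ _ _ _).hom (α_ _ _ _).inv ?_ ?_
    · simp only [nest_hom, MonoidalCategory.tensorHom_def]
      monoidal
    · simp only [nest_inv, MonoidalCategory.tensorHom_def]
      monoidal
  one_mul x := by
    induction x using Tube.arc_induction with
    | zero => simp
    | add x₁ x₂ h₁ h₂ => simp only [map_add, h₁, h₂]
    | of a b c e f h p q =>
    simp only [tubeOne_eq, map_sum, LinearMap.sum_apply, tubeMul_arc]
    -- Among the summands of the unit only the one labelled by the outer edges of the diagram
    -- survives; the Kronecker deltas on the glued edges kill the others. For the right unit law the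
    -- inner edges `e`, `f` play this role.
    rw [sum_sum_eq_of_ne _ c h]
    · simp only [edge_self]
      refine arc_congr (λ_ _).hom (ρ_ _).hom ?_ ?_
      · simp only [nest_hom, MonoidalCategory.tensorHom_def]
        monoidal
      · simp only [nest_inv, MonoidalCategory.tensorHom_def]
        monoidal
    · rintro x y (hx | hy)
      · simp [edge_of_ne hx]
      · simp [edge_of_ne (Ne.symm hy)]
  mul_one x := by
    induction x using Tube.arc_induction with
    | zero => simp
    | add x₁ x₂ h₁ h₂ => simp only [map_add, LinearMap.add_apply, h₁, h₂]
    | of a b c e f h p q =>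
    simp only [tubeOne_eq, map_sum, tubeMul_arc]
    rw [sum_sum_eq_of_ne _ e f]
    · simp only [edge_self]
      refine arc_congr (ρ_ _).hom (λ_ _).hom ?_ ?_
      · simp only [nest_hom, MonoidalCategory.tensorHom_def]
        monoidal
      · simp only [nest_inv, MonoidalCategory.tensorHom_def]
        monoidal
    · rintro x y (hx | hy)
      · simp [edge_of_ne (Ne.symm hx)]
      · simp [edge_of_ne hy]

theorem isAlgebra_lTube : IsAlgebra (lMul (C := C)) lOne where
  assoc x y z := by
    induction x using LTube.arc_induction with
    | zero => simp
    | add x₁ x₂ h₁ h₂ => simp only [map_add, LinearMap.add_apply, h₁, h₂]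
    | of a d e f g p q =>
    induction y using LTube.arc_induction with
    | zero => simp
    | add x₁ x₂ h₁ h₂ => simp only [map_add, LinearMap.add_apply, h₁, h₂]
    | of a' d' e' f' g' p' q' =>
    induction z using LTube.arc_induction with
    | zero => simp
    | add x₁ x₂ h₁ h₂ => simp only [map_add, h₁, h₂]
    | of a'' d'' e'' f'' g'' p'' q'' =>
    simp only [lMul_lArc]
    refine lArc_congr (α_ _ _ _).hom ?_ ?_ <;> monoidal
  one_mul x := by
    induction x using LTube.arc_induction with
    | zero => simp
    | add x₁ x₂ h₁ h₂ => simp only [map_add, h₁, h₂]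
    | of a d e f g p q =>
    simp only [lOne_eq, map_sum, LinearMap.sum_apply, lMul_lArc]
    rw [sum_sum_eq_of_ne _ d g]
    · simp only [edge_self]
      refine lArc_congr (λ_ _).hom ?_ ?_ <;> monoidal
    · rintro x y (hx | hy)
      · simp [edge_of_ne hx]
      · simp [edge_of_ne (Ne.symm hy)]
  mul_one x := by
    induction x using LTube.arc_induction with
    | zero => simp
    | add x₁ x₂ h₁ h₂ => simp only [map_add, LinearMap.add_apply, h₁, h₂]
    | of a d e f g p q =>
    simp only [lOne_eq, map_sum, lMul_lArc]
    rw [sum_sum_eq_of_ne _ e f]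
    · simp only [edge_self]
      refine lArc_congr (ρ_ _).hom ?_ ?_ <;> monoidal
    · rintro x y (hx | hy)
      · simp [edge_of_ne (Ne.symm hx)]
      · simp [edge_of_ne hy]

theorem isAlgebra_rTube : IsAlgebra (rMul (C := C)) rOne where
  assoc x y z := by
    induction x using RTube.arc_induction with
    | zero => simp
    | add x₁ x₂ h₁ h₂ => simp only [map_add, LinearMap.add_apply, h₁, h₂]
    | of b c e f h p q =>
    induction y using RTube.arc_induction with
    | zero => simp
    | add x₁ x₂ h₁ h₂ => simp only [map_add, LinearMap.add_apply, h₁, h₂]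
    | of b' c' e' f' h' p' q' =>
    induction z using RTube.arc_induction with
    | zero => simp
    | add x₁ x₂ h₁ h₂ => simp only [map_add, h₁, h₂]
    | of b'' c'' e'' f'' h'' p'' q'' =>
    simp only [rMul_rArc]
    refine rArc_congr (α_ _ _ _).inv ?_ ?_ <;> monoidal
  one_mul x := by
    induction x using RTube.arc_induction with
    | zero => simp
    | add x₁ x₂ h₁ h₂ => simp only [map_add, h₁, h₂]
    | of b c e f h p q =>
    simp only [rOne_eq, map_sum, LinearMap.sum_apply, rMul_rArc]
    rw [sum_sum_eq_of_ne _ c h]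
    · simp only [edge_self]
      refine rArc_congr (ρ_ _).hom ?_ ?_ <;> monoidal
    · rintro x y (hx | hy)
      · simp [edge_of_ne hx]
      · simp [edge_of_ne (Ne.symm hy)]
  mul_one x := by
    induction x using RTube.arc_induction with
    | zero => simp
    | add x₁ x₂ h₁ h₂ => simp only [map_add, LinearMap.add_apply, h₁, h₂]
    | of b c e f h p q =>
    simp only [rOne_eq, map_sum, rMul_rArc]
    rw [sum_sum_eq_of_ne _ e f]
    · simp only [edge_self]
      refine rArc_congr (λ_ _).hom ?_ ?_ <;> monoidal
    · rintro x y (hx | hy)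
      · simp [edge_of_ne (Ne.symm hx)]
      · simp [edge_of_ne hy]

end Algebras

/-! ### Coproducts and counits of diagrams with arbitrary arcs -/

section Comul

variable {A A' B B' : C} {a b c d e f g h a' b' c' d' e' f' g' h' : Irr C}

theorem arc_add_left (p p' : c.obj ⟶ (A ⊗ e.obj) ⊗ B) (q : (A ⊗ f.obj) ⊗ B ⟶ h.obj) :
    arc A B (p + p') q = arc A B p q + arc A B p' q := by
  simp [arc, TensorProduct.add_tmul]

theorem arc_add_right (p : c.obj ⟶ (A ⊗ e.obj) ⊗ B) (q q' : (A ⊗ f.obj) ⊗ B ⟶ h.obj) :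
    arc A B p (q + q') = arc A B p q + arc A B p q' := by
  simp [arc, TensorProduct.tmul_add]

theorem arc_smul_left (r : ℂ) (p : c.obj ⟶ (A ⊗ e.obj) ⊗ B) (q : (A ⊗ f.obj) ⊗ B ⟶ h.obj) :
    arc A B (r • p) q = r • arc A B p q := by
  simp [arc, ← TensorProduct.smul_tmul']

theorem arc_smul_right (r : ℂ) (p : c.obj ⟶ (A ⊗ e.obj) ⊗ B) (q : (A ⊗ f.obj) ⊗ B ⟶ h.obj) :
    arc A B p (r • q) = r • arc A B p q := by
  simp [arc]

theorem tubeComul_arc_simple (p : c.obj ⟶ (a.obj ⊗ e.obj) ⊗ b.obj)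
    (q : (a.obj ⊗ f.obj) ⊗ b.obj ⟶ h.obj) :
    tubeComul (arc a.obj b.obj p q) =
      ∑ i : Irr C, ∑ m, arc a.obj b.obj ((decomp ((a.obj ⊗ i.obj) ⊗ b.obj)).incl m) q ⊗ₜ[ℂ]
        arc a.obj b.obj p ((decomp ((a.obj ⊗ i.obj) ⊗ b.obj)).proj m) := by
  simp [arc_simple, tubeComul]

theorem lComul_lArc_simple (p : d.obj ⟶ a.obj ⊗ e.obj) (q : a.obj ⊗ f.obj ⟶ g.obj) :
    lComul (lArc a.obj p q) =
      ∑ i : Irr C, ∑ m, lArc a.obj ((decomp (a.obj ⊗ i.obj)).incl m) q ⊗ₜ[ℂ]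
        lArc a.obj p ((decomp (a.obj ⊗ i.obj)).proj m) := by
  simp [lArc_simple, lComul]

theorem rComul_rArc_simple (p : c.obj ⟶ e.obj ⊗ b.obj) (q : f.obj ⊗ b.obj ⟶ h.obj) :
    rComul (rArc b.obj p q) =
      ∑ i : Irr C, ∑ m, rArc b.obj ((decomp (i.obj ⊗ b.obj)).incl m) q ⊗ₜ[ℂ]
        rArc b.obj p ((decomp (i.obj ⊗ b.obj)).proj m) := by
  simp [rArc_simple, rComul]

/-- In `∑ arc (incl ≫ k) q ⊗ arc p (l ≫ proj)`, the sum over dual bases of `Z` can be replaced by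
one over dual bases of `Z'`. -/
theorem sum_arc_tmul_arc {Z Z' : C} (D : SimpleDecomp Z) (D' : SimpleDecomp Z') (k : Z ⟶ Z')
    {i j : Irr C} (l : Z' ⟶ (A ⊗ i.obj) ⊗ B) (m : (A' ⊗ j.obj) ⊗ B' ⟶ Z)
    (p : c.obj ⟶ (A' ⊗ e.obj) ⊗ B') (q : (A ⊗ f.obj) ⊗ B ⟶ h.obj) :
    ∑ n, arc A B (D.incl n ≫ k ≫ l) q ⊗ₜ[ℂ] arc A' B' p (m ≫ D.proj n) =
      ∑ n, arc A B (D'.incl n ≫ l) q ⊗ₜ[ℂ] arc A' B' p (m ≫ k ≫ D'.proj n) := by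
  simpa only [Category.assoc] using SimpleDecomp.sum_comp D D' k
    (fun x u w => arc A B (w ≫ l) q ⊗ₜ[ℂ] arc A' B' p (m ≫ u))
    (by intros; simp only [Preadditive.comp_add, arc_add_right, TensorProduct.tmul_add])
    (by intros; simp only [Preadditive.add_comp, arc_add_left, TensorProduct.add_tmul])
    (by intros; simp only [Linear.comp_smul, Linear.smul_comp, arc_smul_left, arc_smul_right,
          TensorProduct.tmul_smul, TensorProduct.smul_tmul'])

/-- The shape of the coproduct does not depend on the arcs being simple: after both are resolved,
dual bases for the simple arcs are traded for dual bases of `(A ⊗ i) ⊗ B`, and the resolutions of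
`A` and `B` sum to identities. -/
theorem tubeComul_arc (p : c.obj ⟶ (A ⊗ e.obj) ⊗ B) (q : (A ⊗ f.obj) ⊗ B ⟶ h.obj) :
    tubeComul (arc A B p q) =
      ∑ i : Irr C, ∑ m, arc A B ((decomp ((A ⊗ i.obj) ⊗ B)).incl m) q ⊗ₜ[ℂ]
        arc A B p ((decomp ((A ⊗ i.obj) ⊗ B)).proj m) := by
  have key : ∀ (j : Fin (decomp A).n) (k : Fin (decomp B).n) (i : Irr C),
      ∑ m, arc ((decomp A).label j).obj ((decomp B).label k).obj
          ((decomp ((((decomp A).label j).obj ⊗ i.obj) ⊗ ((decomp B).label k).obj)).incl m)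
          ((((decomp A).incl j ▷ f.obj) ⊗ₘ (decomp B).incl k) ≫ q) ⊗ₜ[ℂ]
        arc ((decomp A).label j).obj ((decomp B).label k).obj
          (p ≫ (((decomp A).proj j ▷ e.obj) ⊗ₘ (decomp B).proj k))
          ((decomp ((((decomp A).label j).obj ⊗ i.obj) ⊗ ((decomp B).label k).obj)).proj m) =
      ∑ m, arc A B ((decomp ((A ⊗ i.obj) ⊗ B)).incl m) q ⊗ₜ[ℂ] arc A B p
        ((((decomp A).proj j ≫ (decomp A).incl j) ▷ i.obj ⊗ₘ
          ((decomp B).proj k ≫ (decomp B).incl k)) ≫ (decomp ((A ⊗ i.obj) ⊗ B)).proj m) := by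
    intro j k i
    -- Transport along the inclusions of the summands. Dinaturality then moves the projections into
    -- the second tensor factor, where the idempotents of `A` and `B` appear.
    have := sum_arc_tmul_arc (decomp ((((decomp A).label j).obj ⊗ i.obj) ⊗
      ((decomp B).label k).obj)) (decomp ((A ⊗ i.obj) ⊗ B))
      (((decomp A).incl j ▷ i.obj) ⊗ₘ (decomp B).incl k) (𝟙 _)
      (((decomp A).proj j ▷ i.obj) ⊗ₘ (decomp B).proj k) p q
    simpa only [Category.comp_id, ← arc_dinatural, comp_whiskerRight,
      ← tensorHom_comp_tensorHom, Category.assoc] using this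
  rw [arc_eq_sum]
  simp only [← arc_simple, map_sum, tubeComul_arc_simple, key]
  rw [Finset.sum_congr rfl fun j _ => Finset.sum_comm, Finset.sum_comm]
  refine Finset.sum_congr rfl fun i _ => ?_
  rw [Finset.sum_congr rfl fun j _ => Finset.sum_comm, Finset.sum_comm]
  refine Finset.sum_congr rfl fun m _ => ?_
  simp only [← TensorProduct.tmul_sum, ← arc_sum, ← Preadditive.sum_comp, ← tensor_sum,
    ← sum_whiskerRight, ← sum_tensor, SimpleDecomp.total]
  simp

theorem tubeCounit_arc (p : c.obj ⟶ (A ⊗ e.obj) ⊗ B) (q : (A ⊗ f.obj) ⊗ B ⟶ h.obj) :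
    tubeCounit (arc A B p q) = scalar c (p ≫ (A ◁ edge e f) ▷ B ≫ q ≫ edge h c) := by
  have of : ∀ (a b c e f h : Irr C) (p : c.obj ⟶ (a.obj ⊗ e.obj) ⊗ b.obj)
      (q : (a.obj ⊗ f.obj) ⊗ b.obj ⟶ h.obj), tubeCounit (tubeOf ⟨a, b, c, e, f, h⟩ (p ⊗ₜ[ℂ] q)) =
        scalar c (p ≫ (a.obj ◁ edge e f) ▷ b.obj ≫ q ≫ edge h c) := by
    intros
    simp [tubeCounit]
  have slide : ∀ j k, (p ≫ (((decomp A).proj j ▷ e.obj) ⊗ₘ (decomp B).proj k)) ≫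
      (((decomp A).label j).obj ◁ edge e f) ▷ ((decomp B).label k).obj ≫
        ((((decomp A).incl j ▷ f.obj) ⊗ₘ (decomp B).incl k) ≫ q) ≫ edge h c =
      p ≫ (A ◁ edge e f) ▷ B ≫ (((decomp A).proj j ≫ (decomp A).incl j) ▷ f.obj ⊗ₘ
        ((decomp B).proj k ≫ (decomp B).incl k)) ≫ q ≫ edge h c := by
    intro j k
    simp only [← id_tensorHom, ← tensorHom_id, tensorHom_comp_tensorHom_assoc, Category.assoc,
      tensorHom_comp_tensorHom, Category.id_comp, Category.comp_id]
  rw [arc_eq_sum]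
  simp only [map_sum, of, slide]
  simp only [← map_sum, ← Preadditive.comp_sum, ← Preadditive.sum_comp, ← tensor_sum,
    ← sum_whiskerRight, ← sum_tensor, SimpleDecomp.total]
  simp

theorem lCounit_lArc_simple (p : d.obj ⟶ a.obj ⊗ e.obj) (q : a.obj ⊗ f.obj ⟶ g.obj) :
    lCounit (lArc a.obj p q) = scalar d (p ≫ a.obj ◁ edge e f ≫ q ≫ edge g d) := by
  simp [lArc_simple, lCounit]

theorem rCounit_rArc_simple (p : c.obj ⟶ e.obj ⊗ b.obj) (q : f.obj ⊗ b.obj ⟶ h.obj) :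
    rCounit (rArc b.obj p q) = scalar c (p ≫ edge e f ▷ b.obj ≫ q ≫ edge h c) := by
  simp [rArc_simple, rCounit]

end Comul

/-! ### The boundary tube algebras map to the bulk tube algebra -/

section ToTube

variable {A B : C} {a b c d e f g h : Irr C}

theorem lToTube_lArc (p : d.obj ⟶ A ⊗ e.obj) (q : A ⊗ f.obj ⟶ g.obj) :
    lToTube (lArc A p q) = arc A (𝟙_ C) (p ≫ (ρ_ _).inv) ((ρ_ _).hom ≫ q) := by
  have of : ∀ (a d e f g : Irr C) (p : d.obj ⟶ a.obj ⊗ e.obj) (q : a.obj ⊗ f.obj ⟶ g.obj),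
      lToTube (lOf ⟨a, d, e, f, g⟩ (p ⊗ₜ[ℂ] q)) =
        arc a.obj (𝟙_ C) (p ≫ (ρ_ _).inv) ((ρ_ _).hom ≫ q) := by
    intros
    simp [lToTube, arc]
  have low : ∀ i, (p ≫ (decomp A).proj i ▷ e.obj) ≫ (ρ_ _).inv =
      (p ≫ (ρ_ _).inv) ≫ ((decomp A).proj i ▷ e.obj ⊗ₘ 𝟙 (𝟙_ C)) := by
    simp
  have up : ∀ i, (ρ_ _).hom ≫ (decomp A).incl i ▷ f.obj ≫ q =
      ((decomp A).incl i ▷ f.obj ⊗ₘ 𝟙 (𝟙_ C)) ≫ (ρ_ _).hom ≫ q := by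
    simp
  rw [lArc_eq_sum]
  simp only [map_sum, of, low, up, arc_dinatural]
  simp only [← arc_sum, tensorHom_comp_tensorHom_assoc, ← comp_whiskerRight, Category.comp_id,
    ← Preadditive.sum_comp, ← sum_whiskerRight, ← sum_tensor, SimpleDecomp.total]
  simp

theorem rToTube_rArc (p : c.obj ⟶ e.obj ⊗ B) (q : f.obj ⊗ B ⟶ h.obj) :
    rToTube (rArc B p q) = arc (𝟙_ C) B (p ≫ (λ_ _).inv ▷ B) ((λ_ _).hom ▷ B ≫ q) := by
  have of : ∀ (b c e f h : Irr C) (p : c.obj ⟶ e.obj ⊗ b.obj) (q : f.obj ⊗ b.obj ⟶ h.obj),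
      rToTube (rOf ⟨b, c, e, f, h⟩ (p ⊗ₜ[ℂ] q)) =
        arc (𝟙_ C) b.obj (p ≫ (λ_ _).inv ▷ b.obj) ((λ_ _).hom ▷ b.obj ≫ q) := by
    intros
    simp [rToTube, arc]
  have low : ∀ i, (p ≫ e.obj ◁ (decomp B).proj i) ≫ (λ_ _).inv ▷ _ =
      (p ≫ (λ_ _).inv ▷ B) ≫ (𝟙 (𝟙_ C) ▷ e.obj ⊗ₘ (decomp B).proj i) := by
    simp
  have up : ∀ i, (λ_ _).hom ▷ _ ≫ f.obj ◁ (decomp B).incl i ≫ q =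
      (𝟙 (𝟙_ C) ▷ f.obj ⊗ₘ (decomp B).incl i) ≫ (λ_ _).hom ▷ _ ≫ q := by
    simp
  rw [rArc_eq_sum]
  simp only [map_sum, of, low, up, arc_dinatural]
  simp only [← arc_sum, tensorHom_comp_tensorHom_assoc, ← comp_whiskerRight, Category.comp_id,
    ← Preadditive.sum_comp, ← tensor_sum, SimpleDecomp.total]
  simp

theorem lToTube_lMul (x y : LTube C) :
    lToTube (lMul x y) = tubeMul (lToTube x) (lToTube y) := by
  induction x using LTube.arc_induction with
  | zero => simp
  | add x₁ x₂ h₁ h₂ => simp only [map_add, LinearMap.add_apply, h₁, h₂]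
  | of a d e f g p q =>
  induction y using LTube.arc_induction with
  | zero => simp
  | add x₁ x₂ h₁ h₂ => simp only [map_add, h₁, h₂]
  | of a' d' e' f' g' p' q' =>
  simp only [lMul_lArc, lToTube_lArc, tubeMul_arc]
  -- Multiplying two trivial right arcs gives `𝟙 ⊗ 𝟙`, to which the single trivial arc is compared
  -- by a unitor.
  refine arc_congr (𝟙 _) (λ_ _).inv ?_ ?_
  · simp only [nest_hom, MonoidalCategory.tensorHom_def]
    monoidal
  · simp only [nest_inv, MonoidalCategory.tensorHom_def]
    monoidal

theorem rToTube_rMul (x y : RTube C) :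
    rToTube (rMul x y) = tubeMul (rToTube x) (rToTube y) := by
  induction x using RTube.arc_induction with
  | zero => simp
  | add x₁ x₂ h₁ h₂ => simp only [map_add, LinearMap.add_apply, h₁, h₂]
  | of b c e f h p q =>
  induction y using RTube.arc_induction with
  | zero => simp
  | add x₁ x₂ h₁ h₂ => simp only [map_add, h₁, h₂]
  | of b' c' e' f' h' p' q' =>
  simp only [rMul_rArc, rToTube_rArc, tubeMul_arc]
  refine arc_congr (λ_ _).inv (𝟙 _) ?_ ?_
  · simp only [nest_hom, MonoidalCategory.tensorHom_def]
    monoidal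
  · simp only [nest_inv, MonoidalCategory.tensorHom_def]
    monoidal

theorem lToTube_lOne : lToTube (C := C) lOne = tubeOne := by
  simp only [lOne_eq, tubeOne_eq, map_sum, lToTube_lArc]

theorem rToTube_rOne : rToTube (C := C) rOne = tubeOne := by
  simp only [rOne_eq, tubeOne_eq, map_sum, rToTube_rArc]
  refine Finset.sum_congr rfl fun c _ => Finset.sum_congr rfl fun h _ => ?_
  refine arc_congr (𝟙 _) (𝟙 _) ?_ ?_ <;> simp

/-- The two coproducts sum over dual bases of `a ⊗ i` and of `(a ⊗ i) ⊗ 𝟙`; the right unitor carries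
one to the other. -/
theorem tubeComul_lToTube (x : LTube C) :
    tubeComul (lToTube x) = TensorProduct.map lToTube lToTube (lComul x) := by
  induction x using LTube.arc_induction with
  | zero => simp
  | add x₁ x₂ h₁ h₂ => simp only [map_add, h₁, h₂]
  | of a d e f g p q =>
  simp only [lComul_lArc_simple, lToTube_lArc, map_sum, TensorProduct.map_tmul, tubeComul_arc]
  refine Finset.sum_congr rfl fun i _ => ?_
  have := sum_arc_tmul_arc (decomp (a.obj ⊗ i.obj)) (decomp ((a.obj ⊗ i.obj) ⊗ 𝟙_ C))
    (ρ_ _).inv (𝟙 _) (ρ_ _).hom (p ≫ (ρ_ _).inv) ((ρ_ _).hom ≫ q)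
  simpa using this.symm

theorem tubeComul_rToTube (x : RTube C) :
    tubeComul (rToTube x) = TensorProduct.map rToTube rToTube (rComul x) := by
  induction x using RTube.arc_induction with
  | zero => simp
  | add x₁ x₂ h₁ h₂ => simp only [map_add, h₁, h₂]
  | of b c e f h p q =>
  simp only [rComul_rArc_simple, rToTube_rArc, map_sum, TensorProduct.map_tmul, tubeComul_arc]
  refine Finset.sum_congr rfl fun i _ => ?_
  have := sum_arc_tmul_arc (decomp (i.obj ⊗ b.obj)) (decomp ((𝟙_ C ⊗ i.obj) ⊗ b.obj))
    ((λ_ _).inv ▷ _) (𝟙 _) ((λ_ _).hom ▷ _) (p ≫ (λ_ _).inv ▷ _) ((λ_ _).hom ▷ _ ≫ q)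
  simpa using this.symm

theorem tubeCounit_lToTube (x : LTube C) : tubeCounit (lToTube x) = lCounit x := by
  induction x using LTube.arc_induction with
  | zero => simp
  | add x₁ x₂ h₁ h₂ => simp only [map_add, h₁, h₂]
  | of a d e f g p q => simp [lToTube_lArc, lCounit_lArc_simple, tubeCounit_arc]

theorem tubeCounit_rToTube (x : RTube C) : tubeCounit (rToTube x) = rCounit x := by
  induction x using RTube.arc_induction with
  | zero => simp
  | add x₁ x₂ h₁ h₂ => simp only [map_add, h₁, h₂]
  | of b c e f h p q =>
    simp [rToTube_rArc, rCounit_rArc_simple, tubeCounit_arc]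

end ToTube

/-! ### Gluing -/

section Glue

variable {A B : C} {a b c d e f g h d' g' b' c' e' f' h' : Irr C}

/-- Gluing right diagrams to left diagrams, by multiplication in the bulk tube algebra. -/
def glue : RTube C ⊗[ℂ] LTube C →ₗ[ℂ] Tube C :=
  TensorProduct.lift (tubeMul.compl₁₂ rToTube lToTube)

theorem glue_tmul (r : RTube C) (l : LTube C) :
    glue (r ⊗ₜ[ℂ] l) = tubeMul (rToTube r) (lToTube l) := rfl

/-- The arcs of the product are `𝟙 ⊗ A` and `𝟙 ⊗ B`, and left unitors contract both. What remains is
the glued diagram, with deltas on the joined edges. -/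
theorem glue_arc (μ : c.obj ⟶ d.obj ⊗ B) (γ : g.obj ⊗ B ⟶ h.obj) (ν : d'.obj ⟶ A ⊗ e.obj)
    (ζ : A ⊗ f.obj ⟶ g'.obj) :
    glue (rArc B μ γ ⊗ₜ[ℂ] lArc A ν ζ) =
      arc A B (μ ≫ (edge d d' ≫ ν) ▷ B) ((ζ ≫ edge g' g) ▷ B ≫ γ) := by
  rw [glue_tmul, rToTube_rArc, lToTube_lArc, tubeMul_arc]
  refine arc_congr (λ_ _).hom (λ_ _).hom ?_ ?_
  · simp only [nest_hom, MonoidalCategory.tensorHom_def]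
    monoidal
  · simp only [nest_inv, MonoidalCategory.tensorHom_def]
    monoidal

/-- In the opposite order the arcs are `A ⊗ 𝟙` and `B ⊗ 𝟙`. Contracting them leaves exactly the
rebracketed diagram from which `exchange` is defined. -/
theorem tubeMul_lToTube_rToTube (p : d.obj ⟶ A ⊗ e.obj) (q : A ⊗ f.obj ⟶ g.obj)
    (p' : c'.obj ⟶ e'.obj ⊗ B) (q' : f'.obj ⊗ B ⟶ h'.obj) :
    tubeMul (lToTube (lArc A p q)) (rToTube (rArc B p' q')) =
      arc A B (p ≫ A ◁ (edge e c' ≫ p') ≫ (α_ _ _ _).inv)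
        ((α_ _ _ _).hom ≫ A ◁ (q' ≫ edge h' f) ≫ q) := by
  rw [rToTube_rArc, lToTube_lArc, tubeMul_arc]
  refine arc_congr (ρ_ _).hom (ρ_ _).hom ?_ ?_
  · simp only [nest_hom, MonoidalCategory.tensorHom_def]
    monoidal
  · simp only [nest_inv, MonoidalCategory.tensorHom_def]
    monoidal

theorem cut_tmul (p : d.obj ⟶ (a.obj ⊗ e.obj) ⊗ b.obj) (q : (a.obj ⊗ f.obj) ⊗ b.obj ⟶ g.obj) :
    cut a b d e f g (p ⊗ₜ[ℂ] q) = ∑ m, ∑ n,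
      rArc b.obj (p ≫ (decomp (a.obj ⊗ e.obj)).proj m ▷ b.obj)
          ((decomp (a.obj ⊗ f.obj)).incl n ▷ b.obj ≫ q) ⊗ₜ[ℂ]
        lArc a.obj ((decomp (a.obj ⊗ e.obj)).incl m) ((decomp (a.obj ⊗ f.obj)).proj n) := by
  simp [cut, rArc_simple, lArc_simple, lDiagram]

/-- Regluing the pieces reproduces the resolutions of the identity of `a ⊗ e` and `a ⊗ f`, which sum
to identities. -/
theorem glue_cut (p : d.obj ⟶ (a.obj ⊗ e.obj) ⊗ b.obj)
    (q : (a.obj ⊗ f.obj) ⊗ b.obj ⟶ g.obj) :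
    glue (cut a b d e f g (p ⊗ₜ[ℂ] q)) = arc a.obj b.obj p q := by
  have sum_left : ∀ {n : ℕ} (k : Fin n → (d.obj ⟶ (a.obj ⊗ e.obj) ⊗ b.obj)),
      ∑ m, arc a.obj b.obj (k m) q = arc a.obj b.obj (∑ m, k m) q := by
    simp [arc, TensorProduct.sum_tmul]
  simp only [cut_tmul, map_sum, glue_arc, edge_self, Category.id_comp, Category.comp_id,
    Category.assoc, ← comp_whiskerRight, ← comp_whiskerRight_assoc]
  simp only [← arc_sum, ← sum_whiskerRight, ← Preadditive.sum_comp, ← Preadditive.comp_sum,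
    SimpleDecomp.total, id_whiskerRight, Category.id_comp, Category.comp_id, sum_left]

theorem exchange_arc (p : d.obj ⟶ a.obj ⊗ e.obj) (q : a.obj ⊗ f.obj ⟶ g.obj)
    (p' : c'.obj ⟶ e'.obj ⊗ b.obj) (q' : f'.obj ⊗ b.obj ⟶ h'.obj) :
    exchange (lArc a.obj p q) (rArc b.obj p' q') = cut a b d e' f' g
      ((p ≫ a.obj ◁ (edge e c' ≫ p') ≫ (α_ _ _ _).inv) ⊗ₜ[ℂ]
        ((α_ _ _ _).hom ≫ a.obj ◁ (q' ≫ edge h' f) ≫ q)) := by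
  simp [lArc_simple, rArc_simple, exchange, exLow, exUp]

theorem glue_exchange (l : LTube C) (r : RTube C) :
    glue (exchange l r) = tubeMul (lToTube l) (rToTube r) := by
  induction l using LTube.arc_induction with
  | zero => simp
  | add x₁ x₂ h₁ h₂ => simp only [map_add, LinearMap.add_apply, h₁, h₂]
  | of a d e f g p q =>
  induction r using RTube.arc_induction with
  | zero => simp
  | add x₁ x₂ h₁ h₂ => simp only [map_add, h₁, h₂]
  | of b c' e' f' h' p' q' =>
  rw [exchange_arc, glue_cut, tubeMul_lToTube_rToTube]

theorem glue_map_mul (r : RTube C) (l : LTube C) (z : RTube C ⊗[ℂ] LTube C) :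
    glue (TensorProduct.map (rMul r) (lMul.flip l) z) =
      tubeMul (tubeMul (rToTube r) (glue z)) (lToTube l) := by
  induction z using TensorProduct.induction_on with
  | zero => simp
  | add x y hx hy => simp only [map_add, LinearMap.add_apply, hx, hy]
  | tmul r' l' =>
    simp only [TensorProduct.map_tmul, glue_tmul, LinearMap.flip_apply, rToTube_rMul,
      lToTube_lMul, isAlgebra_tube.assoc]

/-- In the bulk `(r l)(r' l') = r (l r') l'` by associativity, and the middle factor is the glued
exchange. -/
theorem glue_preMul (z w : RTube C ⊗[ℂ] LTube C) :
    glue (preMul z w) = tubeMul (glue z) (glue w) := by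
  induction z using TensorProduct.induction_on with
  | zero => simp
  | add x y hx hy => simp only [map_add, LinearMap.add_apply, hx, hy]
  | tmul r l =>
  induction w using TensorProduct.induction_on with
  | zero => simp
  | add x y hx hy => simp only [map_add, hx, hy]
  | tmul r' l' =>
    rw [preMul_tmul, glue_map_mul, glue_exchange]
    simp only [glue_tmul, isAlgebra_tube.assoc]

theorem cross_eq_zero (h : d ≠ d' ∨ g ≠ g') (μ : c.obj ⟶ d.obj ⊗ b.obj)
    (γ : g.obj ⊗ b.obj ⟶ h'.obj) (ν : d'.obj ⟶ a.obj ⊗ e.obj) (ζ : a.obj ⊗ f.obj ⟶ g'.obj) :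
    cross (rArc b.obj μ γ) (lArc a.obj ν ζ) = 0 := by
  rw [rArc_simple, lArc_simple]
  exact mkQ_of_ne h _ _

theorem glue_eq_zero (h : d ≠ d' ∨ g ≠ g') (μ : c.obj ⟶ d.obj ⊗ B)
    (γ : g.obj ⊗ B ⟶ h'.obj) (ν : d'.obj ⟶ A ⊗ e.obj) (ζ : A ⊗ f.obj ⟶ g'.obj) :
    glue (rArc B μ γ ⊗ₜ[ℂ] lArc A ν ζ) = 0 := by
  rw [glue_arc]
  rcases h with h | h
  · simp [edge_of_ne h]
  · simp [edge_of_ne (Ne.symm h)]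

theorem gluingRelations_le_ker_glue : gluingRelations C ≤ LinearMap.ker (glue (C := C)) := by
  refine Submodule.span_le.2 ?_
  rintro _ ⟨t, s, x, y, hne, rfl⟩
  rw [SetLike.mem_coe, LinearMap.mem_ker]
  induction x using TensorProduct.induction_on with
  | zero => simp
  | add a b ha hb => rw [map_add, TensorProduct.add_tmul, map_add, ha, hb, add_zero]
  | tmul μ γ =>
  induction y using TensorProduct.induction_on with
  | zero => simp
  | add a b ha hb => rw [map_add, TensorProduct.tmul_add, map_add, ha, hb, add_zero]
  | tmul ν ζ =>
  have := glue_eq_zero hne μ γ ν ζ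
  rwa [rArc_simple, lArc_simple] at this

/-- Gluing, as a map from the crossed product. -/
def crossGlue : CrossedProduct C →ₗ[ℂ] Tube C :=
  (gluingRelations C).liftQ glue gluingRelations_le_ker_glue

theorem crossGlue_mkQ (z : RTube C ⊗[ℂ] LTube C) :
    crossGlue ((gluingRelations C).mkQ z) = glue z := rfl

/-- Cutting a bulk diagram into a right and a left diagram. -/
def crossCut : Tube C →ₗ[ℂ] CrossedProduct C :=
  DirectSum.toModule ℂ (TubeLabel C) _ fun t =>
    (gluingRelations C).mkQ ∘ₗ cut t.a t.b t.c t.e t.f t.h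

theorem crossCut_arc (p : c.obj ⟶ (a.obj ⊗ e.obj) ⊗ b.obj)
    (q : (a.obj ⊗ f.obj) ⊗ b.obj ⟶ h.obj) :
    crossCut (arc a.obj b.obj p q) =
      (gluingRelations C).mkQ (cut a b c e f h (p ⊗ₜ[ℂ] q)) := by
  simp [arc_simple, crossCut]

theorem crossGlue_crossCut (x : Tube C) : crossGlue (crossCut x) = x := by
  induction x using Tube.arc_induction with
  | zero => simp
  | add x₁ x₂ h₁ h₂ => simp only [map_add, h₁, h₂]
  | of a b c e f h p q => rw [crossCut_arc, crossGlue_mkQ, glue_cut]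

theorem cross_add_left (r r' : RTube C) (l : LTube C) :
    cross (r + r') l = cross r l + cross r' l := by
  simp [cross, TensorProduct.add_tmul]

theorem cross_add_right (r : RTube C) (l l' : LTube C) :
    cross r (l + l') = cross r l + cross r l' := by
  simp [cross, TensorProduct.tmul_add]

theorem cross_smul_left (k : ℂ) (r : RTube C) (l : LTube C) : cross (k • r) l = k • cross r l := by
  simp [cross, ← TensorProduct.smul_tmul']

theorem cross_smul_right (k : ℂ) (r : RTube C) (l : LTube C) :
    cross r (k • l) = k • cross r l := by
  simp [cross]

/-- Cutting expands `ν` in a basis at the lower joined edge and `ζ` at the upper one. As `d` and `g`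
are simple, both sums collapse by Schur's lemma. This makes cutting a left inverse of gluing on
diagrams with matching labels. -/
theorem mkQ_cut (μ : c.obj ⟶ d.obj ⊗ b.obj) (γ : g.obj ⊗ b.obj ⟶ h.obj)
    (ν : d.obj ⟶ a.obj ⊗ e.obj) (ζ : a.obj ⊗ f.obj ⟶ g.obj) :
    (gluingRelations C).mkQ (cut a b c e f h ((μ ≫ ν ▷ b.obj) ⊗ₜ[ℂ] (ζ ▷ b.obj ≫ γ))) =
      cross (rArc b.obj μ γ) (lArc a.obj ν ζ) := by
  have low : ∀ (x : Irr C) (k : x.obj ⊗ b.obj ⟶ h.obj) (l : a.obj ⊗ f.obj ⟶ x.obj),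
      ∑ m, cross (rArc b.obj (μ ≫ (ν ≫ (decomp (a.obj ⊗ e.obj)).proj m) ▷ b.obj) k)
        (lArc a.obj ((decomp (a.obj ⊗ e.obj)).incl m) l) =
      cross (rArc b.obj (μ ≫ (𝟙 d.obj) ▷ b.obj) k) (lArc a.obj ν l) := fun x k l =>
    SimpleDecomp.sum_of_simple (decomp (a.obj ⊗ e.obj)) ν
      (fun y u w => cross (rArc b.obj (μ ≫ u ▷ b.obj) k) (lArc a.obj w l))
      (by intros; simp [rArc, TensorProduct.add_tmul, cross_add_left])
      (by intros; simp [lArc, TensorProduct.add_tmul, cross_add_right])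
      (by intros; simp [rArc, lArc, ← TensorProduct.smul_tmul', cross_smul_left,
        cross_smul_right])
  have up : ∑ n, cross (rArc b.obj (μ ≫ (𝟙 d.obj) ▷ b.obj)
          (((decomp (a.obj ⊗ f.obj)).incl n ≫ ζ) ▷ b.obj ≫ γ))
        (lArc a.obj ν ((decomp (a.obj ⊗ f.obj)).proj n)) =
      cross (rArc b.obj (μ ≫ (𝟙 d.obj) ▷ b.obj) ((𝟙 g.obj) ▷ b.obj ≫ γ)) (lArc a.obj ν ζ) :=
    SimpleDecomp.sum_to_simple (decomp (a.obj ⊗ f.obj)) ζ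
      (fun y u w => cross (rArc b.obj (μ ≫ (𝟙 d.obj) ▷ b.obj) (w ▷ b.obj ≫ γ)) (lArc a.obj ν u))
      (by intros; simp [lArc, TensorProduct.tmul_add, cross_add_right])
      (by intros; simp [rArc, TensorProduct.tmul_add, cross_add_left])
      (by intros; simp [rArc, lArc, cross_smul_left, cross_smul_right])
  rw [cut_tmul, Finset.sum_comm]
  simp only [map_sum, Category.assoc, ← comp_whiskerRight, ← comp_whiskerRight_assoc]
  refine (Finset.sum_congr rfl fun n _ => low _ _ _).trans (up.trans ?_)
  simp

theorem crossCut_crossGlue (z : CrossedProduct C) : crossCut (crossGlue z) = z := by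
  obtain ⟨z, rfl⟩ := (gluingRelations C).mkQ_surjective z
  rw [crossGlue_mkQ]
  induction z using TensorProduct.induction_on with
  | zero => simp
  | add x y hx hy => simp only [map_add, hx, hy]
  | tmul r l =>
  induction r using RTube.arc_induction with
  | zero => simp
  | add x₁ x₂ h₁ h₂ => simp only [map_add, TensorProduct.add_tmul, h₁, h₂]
  | of b c d g h μ γ =>
  induction l using LTube.arc_induction with
  | zero => simp
  | add x₁ x₂ h₁ h₂ => simp only [map_add, TensorProduct.tmul_add, h₁, h₂]
  | of a d' e f g' ν ζ =>
  -- For mismatched labels the glued diagram vanishes by the deltas and the class vanishes by the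
  -- gluing relations.
  by_cases hne : d ≠ d' ∨ g ≠ g'
  · rw [glue_eq_zero hne, map_zero]
    exact (cross_eq_zero hne μ γ ν ζ).symm
  · push Not at hne
    obtain ⟨rfl, rfl⟩ := hne
    rw [glue_arc, crossCut_arc, edge_self, edge_self, Category.id_comp, Category.comp_id, mkQ_cut]
    rfl

/-- The crossed product is isomorphic to the bulk tube algebra. -/
def crossEquiv : CrossedProduct C ≃ₗ[ℂ] Tube C :=
  LinearEquiv.ofLinearMap crossGlue crossCut (LinearMap.ext crossGlue_crossCut)
    (LinearMap.ext crossCut_crossGlue)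

theorem crossEquiv_cross (r : RTube C) (l : LTube C) :
    crossEquiv (cross r l) = tubeMul (rToTube r) (lToTube l) := rfl

theorem crossEquiv_crossMul (x y : CrossedProduct C) :
    crossEquiv (crossMul x y) = tubeMul (crossEquiv x) (crossEquiv y) := by
  obtain ⟨x, rfl⟩ := (gluingRelations C).mkQ_surjective x
  obtain ⟨y, rfl⟩ := (gluingRelations C).mkQ_surjective y
  exact glue_preMul x y

theorem crossEquiv_crossOne : crossEquiv (C := C) crossOne = tubeOne := by
  rw [crossOne, crossEquiv_cross, rToTube_rOne, lToTube_lOne, isAlgebra_tube.one_mul]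

/-- Transport of structure: the multiplicative bijection onto the bulk algebra reflects the axioms.
-/
theorem isAlgebra_crossedProduct : IsAlgebra (crossMul (C := C)) crossOne where
  assoc x y z := crossEquiv.injective (by simp only [crossEquiv_crossMul, isAlgebra_tube.assoc])
  one_mul x := crossEquiv.injective (by
    rw [crossEquiv_crossMul, crossEquiv_crossOne, isAlgebra_tube.one_mul])
  mul_one x := crossEquiv.injective (by
    rw [crossEquiv_crossMul, crossEquiv_crossOne, isAlgebra_tube.mul_one])

theorem crossEquiv_arc (μ : c.obj ⟶ d.obj ⊗ B) (γ : g.obj ⊗ B ⟶ h.obj) (ν : d'.obj ⟶ A ⊗ e.obj)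
    (ζ : A ⊗ f.obj ⟶ g'.obj) :
    crossEquiv (cross (rArc B μ γ) (lArc A ν ζ)) =
      arc A B (μ ≫ (edge d d' ≫ ν) ▷ B) ((ζ ≫ edge g' g) ▷ B ≫ γ) :=
  glue_arc μ γ ν ζ

end Glue

/-! ### Compatibility of gluing with comultiplication -/

section CrossComul

variable {A B : C} {a b c d e f g h d' g' : Irr C}

theorem crossComul_cross (μ : c.obj ⟶ d.obj ⊗ b.obj) (γ : g.obj ⊗ b.obj ⟶ h.obj)
    (ν : d'.obj ⟶ a.obj ⊗ e.obj) (ζ : a.obj ⊗ f.obj ⟶ g'.obj) :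
    crossComul (cross (rArc b.obj μ γ) (lArc a.obj ν ζ)) = ∑ i : Irr C, ∑ n, ∑ j : Irr C, ∑ m,
      cross (rArc b.obj ((decomp (j.obj ⊗ b.obj)).incl m) γ)
          (lArc a.obj ((decomp (a.obj ⊗ i.obj)).incl n) ζ) ⊗ₜ[ℂ]
        cross (rArc b.obj μ ((decomp (j.obj ⊗ b.obj)).proj m))
          (lArc a.obj ν ((decomp (a.obj ⊗ i.obj)).proj n)) := by
  change preComul (rArc b.obj μ γ ⊗ₜ[ℂ] lArc a.obj ν ζ) = _
  simp only [preComul, LinearMap.comp_apply, TensorProduct.map_tmul, rComul_rArc_simple,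
    lComul_lArc_simple, TensorProduct.tmul_sum, TensorProduct.sum_tmul, map_sum,
    LinearEquiv.coe_coe, TensorProduct.tensorTensorTensorComm_tmul]
  rfl

/-- The bulk coproduct uses dual bases of `(a ⊗ i) ⊗ b`. The crossed coproduct splits `a ⊗ i` into
simple objects first and then each `j ⊗ b`, where `j` must be the summand just chosen. Both resolve
the same identity. -/
theorem tubeComul_crossEquiv (x : CrossedProduct C) :
    tubeComul (crossEquiv x) =
      TensorProduct.map crossEquiv.toLinearMap crossEquiv.toLinearMap (crossComul x) := by
  obtain ⟨z, rfl⟩ := (gluingRelations C).mkQ_surjective x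
  induction z using TensorProduct.induction_on with
  | zero => simp
  | add x y hx hy => simp only [map_add, hx, hy]
  | tmul r l =>
  induction r using RTube.arc_induction with
  | zero => simp
  | add x₁ x₂ h₁ h₂ => simp only [map_add, TensorProduct.add_tmul, h₁, h₂]
  | of b c d g h μ γ =>
  induction l using LTube.arc_induction with
  | zero => simp
  | add x₁ x₂ h₁ h₂ => simp only [map_add, TensorProduct.tmul_add, h₁, h₂]
  | of a d' e f g' ν ζ =>
  change tubeComul (crossEquiv (cross (rArc b.obj μ γ) (lArc a.obj ν ζ))) =
    TensorProduct.map crossEquiv.toLinearMap crossEquiv.toLinearMap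
      (crossComul (cross (rArc b.obj μ γ) (lArc a.obj ν ζ)))
  rw [crossComul_cross, crossEquiv_arc, tubeComul_arc_simple]
  simp only [map_sum, TensorProduct.map_tmul, LinearEquiv.coe_coe, crossEquiv_arc]
  refine Finset.sum_congr rfl fun i _ => ?_
  set P := μ ≫ (edge d d' ≫ ν) ▷ b.obj
  set Q := (ζ ≫ edge g' g) ▷ b.obj ≫ γ
  set D := decomp (a.obj ⊗ i.obj)
  set E := decomp ((a.obj ⊗ i.obj) ⊗ b.obj)
  have inner : ∀ n, (∑ j : Irr C, ∑ m,
      arc a.obj b.obj ((decomp (j.obj ⊗ b.obj)).incl m ≫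
        (edge j (D.label n) ≫ D.incl n) ▷ b.obj) Q ⊗ₜ[ℂ]
      arc a.obj b.obj P ((D.proj n ≫ edge (D.label n) j) ▷ b.obj ≫
        (decomp (j.obj ⊗ b.obj)).proj m)) =
      ∑ m, arc a.obj b.obj (E.incl m) Q ⊗ₜ[ℂ]
        arc a.obj b.obj P ((D.proj n ≫ D.incl n) ▷ b.obj ≫ E.proj m) := by
    intro n
    -- Gluing forces the edge `j` inserted on the right to be the summand of `a ⊗ i` chosen on the
    -- left.
    rw [Finset.sum_eq_single (D.label n)]
    · simpa using sum_arc_tmul_arc (decomp ((D.label n).obj ⊗ b.obj)) E (D.incl n ▷ b.obj) (𝟙 _)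
        (D.proj n ▷ b.obj) P Q
    · intro j _ hj
      simp [edge_of_ne hj]
    · simp
  rw [Finset.sum_congr rfl fun n _ => inner n, Finset.sum_comm]
  refine Finset.sum_congr rfl fun m _ => ?_
  simp only [← TensorProduct.tmul_sum, ← arc_sum, ← Preadditive.sum_comp, ← sum_whiskerRight,
    D.total, id_whiskerRight, Category.id_comp]

end CrossComul

/-! ### The images of the boundary tube algebras -/

section Range

variable {A B : C} {a b c d e f g h : Irr C}

theorem isUnitLabel_label (j : Fin (decomp (𝟙_ C)).n) : IsUnitLabel ((decomp (𝟙_ C)).label j) := by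
  refine ⟨(decomp (𝟙_ C)).proj j, fun h => ?_⟩
  have : Simple ((decomp (𝟙_ C)).label j).obj := ((decomp (𝟙_ C)).label j).2
  refine id_nonzero ((decomp (𝟙_ C)).label j).obj ?_
  rw [← (decomp (𝟙_ C)).incl_proj_self j, h, comp_zero]

/-- A nonzero map out of `𝟙` is nonzero on some summand of the decomposition, and Schur's lemma
identifies that summand with `b`. -/
theorem IsUnitLabel.exists_label_eq {b : Irr C} (hb : IsUnitLabel b) :
    ∃ j, (decomp (𝟙_ C)).label j = b := by
  obtain ⟨f, hf⟩ := hb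
  by_contra! hne
  apply hf
  rw [← Category.id_comp f, ← (decomp (𝟙_ C)).total, Preadditive.sum_comp]
  refine Finset.sum_eq_zero fun j _ => ?_
  rw [Category.assoc, hom_eq_zero_of_ne (hne j) ((decomp (𝟙_ C)).incl j ≫ f), comp_zero]

theorem diagram_eq_arc (μ : c.obj ⟶ d.obj ⊗ b.obj) (ν : d.obj ⟶ a.obj ⊗ e.obj)
    (ζ : a.obj ⊗ f.obj ⟶ g.obj) (γ : g.obj ⊗ b.obj ⟶ h.obj) :
    diagram μ ν ζ γ = arc a.obj b.obj (μ ≫ ν ▷ b.obj) (ζ ▷ b.obj ≫ γ) :=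
  (arc_simple _ _).symm

theorem arc_eq_sum_diagram (p : c.obj ⟶ (a.obj ⊗ e.obj) ⊗ b.obj)
    (q : (a.obj ⊗ f.obj) ⊗ b.obj ⟶ h.obj) :
    arc a.obj b.obj p q = ∑ m, ∑ n,
      diagram (p ≫ (decomp (a.obj ⊗ e.obj)).proj m ▷ b.obj) ((decomp (a.obj ⊗ e.obj)).incl m)
        ((decomp (a.obj ⊗ f.obj)).proj n) ((decomp (a.obj ⊗ f.obj)).incl n ▷ b.obj ≫ q) := by
  rw [← glue_cut, cut_tmul]
  simp only [map_sum, glue_arc, edge_self, Category.id_comp, Category.comp_id, diagram_eq_arc]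

/-- Only the right arc is resolved, because the left arc of a diagram in the image of `lToTube`
stays as it is. -/
theorem arc_eq_sum_right (p : c.obj ⟶ (A ⊗ e.obj) ⊗ B) (q : (A ⊗ f.obj) ⊗ B ⟶ h.obj) :
    arc A B p q = ∑ j, arc A ((decomp B).label j).obj (p ≫ (A ⊗ e.obj) ◁ (decomp B).proj j)
      ((A ⊗ f.obj) ◁ (decomp B).incl j ≫ q) := by
  have key : ∀ j, arc A ((decomp B).label j).obj (p ≫ (A ⊗ e.obj) ◁ (decomp B).proj j)
      ((A ⊗ f.obj) ◁ (decomp B).incl j ≫ q) =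
      arc A B p ((A ⊗ f.obj) ◁ ((decomp B).proj j ≫ (decomp B).incl j) ≫ q) := fun j =>
    (arc_congr (𝟙 A) ((decomp B).proj j) (by simp) (by simp)).symm
  simp only [key, ← arc_sum, ← Preadditive.sum_comp, ← whiskerLeft_sum, SimpleDecomp.total]
  simp

theorem arc_eq_sum_left (p : c.obj ⟶ (A ⊗ e.obj) ⊗ B) (q : (A ⊗ f.obj) ⊗ B ⟶ h.obj) :
    arc A B p q = ∑ j, arc ((decomp A).label j).obj B (p ≫ ((decomp A).proj j ▷ e.obj) ▷ B)
      (((decomp A).incl j ▷ f.obj) ▷ B ≫ q) := by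
  have key : ∀ j, arc ((decomp A).label j).obj B (p ≫ ((decomp A).proj j ▷ e.obj) ▷ B)
      (((decomp A).incl j ▷ f.obj) ▷ B ≫ q) =
      arc A B p ((((decomp A).proj j ≫ (decomp A).incl j) ▷ f.obj) ▷ B ≫ q) := fun j =>
    (arc_congr ((decomp A).proj j) (𝟙 B) (by simp) (by simp)).symm
  simp only [key, ← arc_sum, ← Preadditive.sum_comp, ← sum_whiskerRight, SimpleDecomp.total]
  simp

theorem range_lToTube : LinearMap.range (lToTube (C := C)) = leftPart C := by
  apply le_antisymm
  · rintro _ ⟨x, rfl⟩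
    induction x using LTube.arc_induction with
    | zero => simp
    | add x₁ x₂ h₁ h₂ => rw [map_add]; exact add_mem h₁ h₂
    | of a d e f g p q =>
      rw [lToTube_lArc, arc_eq_sum_right]
      refine sum_mem fun j _ => ?_
      rw [arc_eq_sum_diagram]
      exact sum_mem fun m _ => sum_mem fun n _ =>
        Submodule.subset_span ⟨_, _, _, _, _, _, _, _, _, _, _, _, isUnitLabel_label j, rfl⟩
  · refine Submodule.span_le.2 ?_
    rintro _ ⟨a, b, c, d, e, f, g, h, μ, ν, ζ, γ, hb, rfl⟩
    obtain ⟨j, rfl⟩ := hb.exists_label_eq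
    rw [diagram_eq_arc]
    -- The preimage closes the right arc with the inclusion into `𝟙` below and the projection from
    -- `𝟙` above. Adding the trivial arc back composes inclusion with projection, which is the
    -- identity of the summand.
    refine ⟨lArc a.obj ((μ ≫ ν ▷ _) ≫ _ ◁ (decomp (𝟙_ C)).incl j ≫ (ρ_ _).hom)
      ((ρ_ _).inv ≫ _ ◁ (decomp (𝟙_ C)).proj j ≫ ζ ▷ _ ≫ γ), ?_⟩
    rw [lToTube_lArc]
    refine (arc_congr (𝟙 _) ((decomp (𝟙_ C)).incl j) (p := μ ≫ ν ▷ _) (by simp) ?_).symm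
    simp only [id_whiskerRight, id_tensorHom, Iso.hom_inv_id_assoc,
      ← MonoidalCategory.whiskerLeft_comp_assoc, (decomp (𝟙_ C)).incl_proj_self]
    simp

theorem range_rToTube : LinearMap.range (rToTube (C := C)) = rightPart C := by
  apply le_antisymm
  · rintro _ ⟨x, rfl⟩
    induction x using RTube.arc_induction with
    | zero => simp
    | add x₁ x₂ h₁ h₂ => rw [map_add]; exact add_mem h₁ h₂
    | of b c e f h p q =>
      rw [rToTube_rArc, arc_eq_sum_left]
      refine sum_mem fun j _ => ?_
      rw [arc_eq_sum_diagram]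
      exact sum_mem fun m _ => sum_mem fun n _ =>
        Submodule.subset_span ⟨_, _, _, _, _, _, _, _, _, _, _, _, isUnitLabel_label j, rfl⟩
  · refine Submodule.span_le.2 ?_
    rintro _ ⟨a, b, c, d, e, f, g, h, μ, ν, ζ, γ, ha, rfl⟩
    obtain ⟨j, rfl⟩ := ha.exists_label_eq
    rw [diagram_eq_arc]
    refine ⟨rArc b.obj ((μ ≫ ν ▷ _) ≫ ((decomp (𝟙_ C)).incl j ▷ _) ▷ _ ≫ (λ_ _).hom ▷ _)
      ((λ_ _).inv ▷ _ ≫ ((decomp (𝟙_ C)).proj j ▷ _) ▷ _ ≫ ζ ▷ _ ≫ γ), ?_⟩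
    rw [rToTube_rArc]
    refine (arc_congr ((decomp (𝟙_ C)).incl j) (𝟙 _) (p := μ ≫ ν ▷ _) ?_ ?_).symm
    · simp [← comp_whiskerRight]
    · simp only [tensorHom_id, ← comp_whiskerRight_assoc, (decomp (𝟙_ C)).incl_proj_self,
        Iso.hom_inv_id_assoc]
      simp

end Range

/-! ### The kernels -/

section Kernel

variable {A B : C} {a b c d e f g h : Irr C}

/-- The Eckmann–Hilton argument: `s` acts on the left and `t` on the right factor of `𝟙 ⊗ 𝟙`, and
the interchange law applies. -/
theorem unit_comp_comm (s t : 𝟙_ C ⟶ 𝟙_ C) : s ≫ t = t ≫ s := by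
  have hs : s = (λ_ (𝟙_ C)).inv ≫ s ▷ 𝟙_ C ≫ (λ_ (𝟙_ C)).hom := by
    rw [unitors_equal, unitors_inv_equal]
    simp
  have ht : t = (λ_ (𝟙_ C)).inv ≫ 𝟙_ C ◁ t ≫ (λ_ (𝟙_ C)).hom := by simp
  rw [hs, ht]
  simp only [Category.assoc, Iso.hom_inv_id_assoc]
  rw [whisker_exchange_assoc]

/-- The tensor unit is multiplicity free. -/
theorem proj_edge_incl_of_ne (D : SimpleDecomp (𝟙_ C)) {j k : Fin D.n} (h : j ≠ k) :
    D.proj j ≫ edge _ _ ≫ D.incl k = 0 := by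
  have h₁ : D.proj j ≫ edge _ _ ≫ D.incl k =
      (D.proj j ≫ D.incl j) ≫ D.proj j ≫ edge _ _ ≫ D.incl k := by
    rw [Category.assoc, reassoc_of% D.incl_proj_self j]
  rw [h₁, unit_comp_comm]
  simp only [Category.assoc]
  rw [reassoc_of% D.incl_proj_ne k j h.symm]
  simp

/-- By Schur's lemma the idempotent acts on `x` as a scalar `r`. On the summand `x ⊗ 𝟙_k` it acts as
the identity, and this summand is nonzero, so `r = 1`. -/
theorem whiskerLeft_unit_idempotent (D : SimpleDecomp (𝟙_ C)) {x : Irr C}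
    {k : Fin D.n}
    (h : ¬ IsZero (x.obj ⊗ (D.label k).obj)) :
    x.obj ◁ (D.proj k ≫ D.incl k) = 𝟙 _ := by
  obtain ⟨r, hr⟩ := exists_eq_smul_id
    ((ρ_ x.obj).inv ≫ x.obj ◁ (D.proj k ≫ D.incl k) ≫ (ρ_ x.obj).hom)
  have hr' : x.obj ◁ (D.proj k ≫ D.incl k) = r • 𝟙 _ := by
    rw [← cancel_epi (ρ_ x.obj).inv, ← cancel_mono (ρ_ x.obj).hom, Category.assoc, hr]
    simp
  have hk : r • 𝟙 (x.obj ⊗ (D.label k).obj) = 𝟙 _ := by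
    have : x.obj ◁ D.incl k ≫ x.obj ◁ (D.proj k ≫ D.incl k) ≫ x.obj ◁ D.proj k = 𝟙 _ := by
      simp only [← MonoidalCategory.whiskerLeft_comp, Category.assoc, D.incl_proj_self,
        Category.comp_id, MonoidalCategory.whiskerLeft_id]
    rw [hr'] at this
    simpa [← MonoidalCategory.whiskerLeft_comp, D.incl_proj_self] using this
  have hr1 : r = 1 := by
    by_contra hne
    apply h
    rw [IsZero.iff_id_eq_zero]
    have : (r - 1) • 𝟙 (x.obj ⊗ (D.label k).obj) = 0 := by rw [sub_smul, hk, one_smul, sub_self]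
    exact (smul_eq_zero.1 this).resolve_left (sub_ne_zero.2 hne)
  rw [hr', hr1, one_smul]

theorem whiskerRight_unit_idempotent (D : SimpleDecomp (𝟙_ C)) {x : Irr C}
    {k : Fin D.n}
    (h : ¬ IsZero ((D.label k).obj ⊗ x.obj)) :
    (D.proj k ≫ D.incl k) ▷ x.obj = 𝟙 _ := by
  obtain ⟨r, hr⟩ := exists_eq_smul_id
    ((λ_ x.obj).inv ≫ (D.proj k ≫ D.incl k) ▷ x.obj ≫ (λ_ x.obj).hom)
  have hr' : (D.proj k ≫ D.incl k) ▷ x.obj = r • 𝟙 _ := by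
    rw [← cancel_epi (λ_ x.obj).inv, ← cancel_mono (λ_ x.obj).hom, Category.assoc, hr]
    simp
  have hk : r • 𝟙 ((D.label k).obj ⊗ x.obj) = 𝟙 _ := by
    have : D.incl k ▷ x.obj ≫ (D.proj k ≫ D.incl k) ▷ x.obj ≫ D.proj k ▷ x.obj = 𝟙 _ := by
      simp only [← comp_whiskerRight, Category.assoc, D.incl_proj_self,
        Category.comp_id, id_whiskerRight]
    rw [hr'] at this
    simpa [← comp_whiskerRight, D.incl_proj_self] using this
  have hr1 : r = 1 := by
    by_contra hne
    apply h
    rw [IsZero.iff_id_eq_zero]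
    have : (r - 1) • 𝟙 ((D.label k).obj ⊗ x.obj) = 0 := by rw [sub_smul, hk, one_smul, sub_self]
    exact (smul_eq_zero.1 this).resolve_left (sub_ne_zero.2 hne)
  rw [hr', hr1, one_smul]

/-- Closing up the added arc leaves the endomorphism `s ≫ t` of `𝟙`; the interchange law moves it
past the vertex onto the outer edge, where it acts through a simple object. The other three slides
do this for the upper half and for the left arc. -/
theorem rightUnitor_slide_low {W X Y : C} (s : 𝟙_ C ⟶ X) (t : X ⟶ 𝟙_ C) (k : W ⟶ Y) :
    ((ρ_ W).inv ≫ W ◁ s ≫ k ▷ X) ≫ Y ◁ t ≫ (ρ_ Y).hom =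
      (ρ_ W).inv ≫ W ◁ (s ≫ t) ≫ (ρ_ W).hom ≫ k := by
  simp [← whisker_exchange_assoc]

theorem rightUnitor_slide_up {W X Y : C} (s : X ⟶ 𝟙_ C) (t : 𝟙_ C ⟶ X) (k : Y ⟶ W) :
    ((ρ_ Y).inv ≫ Y ◁ t) ≫ k ▷ X ≫ W ◁ s ≫ (ρ_ W).hom =
      k ≫ (ρ_ W).inv ≫ W ◁ (t ≫ s) ≫ (ρ_ W).hom := by
  simp [whisker_exchange_assoc]

theorem leftUnitor_slide_low {W X Y Z : C} (s : 𝟙_ C ⟶ X) (t : X ⟶ 𝟙_ C) (k : W ⟶ Y ⊗ Z) :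
    ((λ_ W).inv ≫ s ▷ W ≫ X ◁ k ≫ (α_ X Y Z).inv) ≫ (t ▷ Y ≫ (λ_ Y).hom) ▷ Z =
      (λ_ W).inv ≫ (s ≫ t) ▷ W ≫ (λ_ W).hom ≫ k := by
  have : (α_ X Y Z).inv ≫ (t ▷ Y ≫ (λ_ Y).hom) ▷ Z = t ▷ (Y ⊗ Z) ≫ (λ_ (Y ⊗ Z)).hom := by simp
  rw [Category.assoc, Category.assoc, Category.assoc, this, whisker_exchange_assoc]
  simp

theorem leftUnitor_slide_up {W X Y Z : C} (s : X ⟶ 𝟙_ C) (t : 𝟙_ C ⟶ X) (k : Y ⊗ Z ⟶ W) :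
    ((λ_ Y).inv ≫ t ▷ Y) ▷ Z ≫ (α_ X Y Z).hom ≫ X ◁ k ≫ s ▷ W ≫ (λ_ W).hom =
      k ≫ (λ_ W).inv ≫ (t ≫ s) ▷ W ≫ (λ_ W).hom := by
  have : ((λ_ Y).inv ≫ t ▷ Y) ▷ Z ≫ (α_ X Y Z).hom = (λ_ (Y ⊗ Z)).inv ≫ t ▷ (Y ⊗ Z) := by simp
  rw [reassoc_of% this, ← whisker_exchange_assoc]
  simp

theorem lToTube_eq_sum (ν : d.obj ⟶ a.obj ⊗ e.obj) (ζ : a.obj ⊗ f.obj ⟶ g.obj) :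
    lToTube (lArc a.obj ν ζ) = ∑ j, arc a.obj ((decomp (𝟙_ C)).label j).obj
      ((ρ_ _).inv ≫ d.obj ◁ (decomp (𝟙_ C)).proj j ≫ ν ▷ _)
      (ζ ▷ _ ≫ g.obj ◁ (decomp (𝟙_ C)).incl j ≫ (ρ_ _).hom) := by
  rw [lToTube_lArc, arc_eq_sum_right]
  refine Finset.sum_congr rfl fun j _ => ?_
  refine arc_congr (𝟙 _) (𝟙 _) ?_ ?_
  · simp [whisker_exchange]
  · simp [← whisker_exchange_assoc]

theorem rToTube_eq_sum (μ : c.obj ⟶ d.obj ⊗ b.obj) (γ : g.obj ⊗ b.obj ⟶ h.obj) :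
    rToTube (rArc b.obj μ γ) = ∑ j, arc ((decomp (𝟙_ C)).label j).obj b.obj
      ((λ_ _).inv ≫ (decomp (𝟙_ C)).proj j ▷ c.obj ≫ _ ◁ μ ≫ (α_ _ _ _).inv)
      ((α_ _ _ _).hom ≫ _ ◁ γ ≫ (decomp (𝟙_ C)).incl j ▷ h.obj ≫ (λ_ _).hom) := by
  rw [rToTube_rArc, arc_eq_sum_left]
  refine Finset.sum_congr rfl fun j _ => ?_
  refine arc_congr (𝟙 _) (𝟙 _) ?_ ?_
  · simp [← whisker_exchange_assoc]
  · simp [whisker_exchange_assoc]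

/-- A retraction of `lToTube` on diagrams whose outer edges lie in the same column. -/
def tubeToL : Tube C →ₗ[ℂ] LTube C :=
  DirectSum.toModule ℂ (TubeLabel C) _ fun t =>
    ∑ k, lOf ⟨t.a, t.c, t.e, t.f, t.h⟩ ∘ₗ
      TensorProduct.map
        (Linear.rightComp ℂ t.c.obj
          (_ ◁ (edge t.b ((decomp (𝟙_ C)).label k) ≫ (decomp (𝟙_ C)).incl k) ≫ (ρ_ _).hom))
        (Linear.leftComp ℂ t.h.obj
          ((ρ_ _).inv ≫ _ ◁ ((decomp (𝟙_ C)).proj k ≫ edge ((decomp (𝟙_ C)).label k) t.b)))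

/-- A retraction of `rToTube` on diagrams whose outer edges lie in the same row. -/
def tubeToR : Tube C →ₗ[ℂ] RTube C :=
  DirectSum.toModule ℂ (TubeLabel C) _ fun t =>
    ∑ k, rOf ⟨t.b, t.c, t.e, t.f, t.h⟩ ∘ₗ
      TensorProduct.map
        (Linear.rightComp ℂ t.c.obj
          (((edge t.a ((decomp (𝟙_ C)).label k) ≫ (decomp (𝟙_ C)).incl k) ▷ _ ≫ (λ_ _).hom) ▷ _))
        (Linear.leftComp ℂ t.h.obj
          (((λ_ _).inv ≫ ((decomp (𝟙_ C)).proj k ≫ edge ((decomp (𝟙_ C)).label k) t.a) ▷ _) ▷ _))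

theorem tubeToL_arc (p : c.obj ⟶ (a.obj ⊗ e.obj) ⊗ b.obj)
    (q : (a.obj ⊗ f.obj) ⊗ b.obj ⟶ h.obj) :
    tubeToL (arc a.obj b.obj p q) = ∑ k, lArc a.obj
      (p ≫ _ ◁ (edge b ((decomp (𝟙_ C)).label k) ≫ (decomp (𝟙_ C)).incl k) ≫ (ρ_ _).hom)
      (((ρ_ _).inv ≫ _ ◁ ((decomp (𝟙_ C)).proj k ≫ edge ((decomp (𝟙_ C)).label k) b)) ≫ q) := by
  simp only [arc_simple, lArc_simple]
  simp [tubeToL]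

theorem tubeToR_arc (p : c.obj ⟶ (a.obj ⊗ e.obj) ⊗ b.obj)
    (q : (a.obj ⊗ f.obj) ⊗ b.obj ⟶ h.obj) :
    tubeToR (arc a.obj b.obj p q) = ∑ k, rArc b.obj
      (p ≫ ((edge a ((decomp (𝟙_ C)).label k) ≫ (decomp (𝟙_ C)).incl k) ▷ _ ≫ (λ_ _).hom) ▷ _)
      (((λ_ _).inv ≫ ((decomp (𝟙_ C)).proj k ≫ edge ((decomp (𝟙_ C)).label k) a) ▷ _) ▷ _ ≫
        q) := by
  simp only [arc_simple, rArc_simple]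
  simp [tubeToR]

theorem tubeToL_lToTube (hdg : SameColumn d g) (ν : d.obj ⟶ a.obj ⊗ e.obj)
    (ζ : a.obj ⊗ f.obj ⟶ g.obj) : tubeToL (lToTube (lArc a.obj ν ζ)) = lArc a.obj ν ζ := by
  obtain ⟨b, hb, hd, hg⟩ := hdg
  obtain ⟨k, rfl⟩ := hb.exists_label_eq
  rw [lToTube_eq_sum]
  simp only [map_sum, tubeToL_arc, rightUnitor_slide_low, rightUnitor_slide_up]
  -- The outer sum runs over the summands on the added arc, the inner one over those in the
  -- retraction. Outer terms other than `k` vanish because the `k`-th idempotent is already the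
  -- identity on `d`; inner ones vanish because `𝟙` is multiplicity free.
  rw [Finset.sum_eq_single k, Finset.sum_eq_single k]
  · simp only [edge_self, Category.id_comp, whiskerLeft_unit_idempotent _ hd,
      whiskerLeft_unit_idempotent _ hg, Iso.inv_hom_id_assoc, Iso.inv_hom_id, Category.comp_id]
  · intro j _ hj
    rw [proj_edge_incl_of_ne _ hj.symm]
    simp
  · simp
  · intro j _ hj
    refine Finset.sum_eq_zero fun i _ => ?_
    rw [← Category.id_comp (d.obj ◁ _), ← whiskerLeft_unit_idempotent _ hd,
      ← MonoidalCategory.whiskerLeft_comp, Category.assoc,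
      reassoc_of% (decomp (𝟙_ C)).incl_proj_ne k j hj.symm]
    simp
  · simp

theorem tubeToR_rToTube (hch : SameRow c h) (μ : c.obj ⟶ d.obj ⊗ b.obj)
    (γ : g.obj ⊗ b.obj ⟶ h.obj) : tubeToR (rToTube (rArc b.obj μ γ)) = rArc b.obj μ γ := by
  obtain ⟨a, ha, hc, hh⟩ := hch
  obtain ⟨k, rfl⟩ := ha.exists_label_eq
  rw [rToTube_eq_sum]
  simp only [map_sum, tubeToR_arc, leftUnitor_slide_low, leftUnitor_slide_up]
  rw [Finset.sum_eq_single k, Finset.sum_eq_single k]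
  · simp only [edge_self, Category.id_comp, whiskerRight_unit_idempotent _ hc,
      whiskerRight_unit_idempotent _ hh, Iso.inv_hom_id_assoc, Iso.inv_hom_id, Category.comp_id]
  · intro j _ hj
    rw [proj_edge_incl_of_ne _ hj.symm]
    simp
  · simp
  · intro j _ hj
    refine Finset.sum_eq_zero fun i _ => ?_
    rw [← Category.id_comp (_ ▷ c.obj), ← whiskerRight_unit_idempotent _ hc,
      ← comp_whiskerRight, Category.assoc,
      reassoc_of% (decomp (𝟙_ C)).incl_proj_ne k j hj.symm]
    simp
  · simp

/-- For every summand of `𝟙` on the added arc, either the lower half factors through a zero object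
at `d` or the upper half does at `g`. -/
theorem lToTube_eq_zero (hdg : ¬ SameColumn d g) (ν : d.obj ⟶ a.obj ⊗ e.obj)
    (ζ : a.obj ⊗ f.obj ⟶ g.obj) : lToTube (lArc a.obj ν ζ) = 0 := by
  rw [lToTube_eq_sum]
  refine Finset.sum_eq_zero fun j _ => ?_
  by_cases hd : IsZero (d.obj ⊗ ((decomp (𝟙_ C)).label j).obj)
  · rw [hd.eq_zero_of_tgt (d.obj ◁ _)]
    simp
  · have hg : IsZero (g.obj ⊗ ((decomp (𝟙_ C)).label j).obj) := by
      by_contra hg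
      exact hdg ⟨_, isUnitLabel_label j, hd, hg⟩
    rw [hg.eq_zero_of_src (g.obj ◁ _)]
    simp

theorem rToTube_eq_zero (hch : ¬ SameRow c h) (μ : c.obj ⟶ d.obj ⊗ b.obj)
    (γ : g.obj ⊗ b.obj ⟶ h.obj) : rToTube (rArc b.obj μ γ) = 0 := by
  rw [rToTube_eq_sum]
  refine Finset.sum_eq_zero fun j _ => ?_
  by_cases hc : IsZero (((decomp (𝟙_ C)).label j).obj ⊗ c.obj)
  · rw [hc.eq_zero_of_tgt (_ ▷ c.obj)]
    simp
  · have hh : IsZero (((decomp (𝟙_ C)).label j).obj ⊗ h.obj) := by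
      by_contra hh
      exact hch ⟨_, isUnitLabel_label j, hc, hh⟩
    rw [hh.eq_zero_of_src (_ ▷ h.obj)]
    simp

theorem lDiagram_eq_lArc (ν : d.obj ⟶ a.obj ⊗ e.obj) (ζ : a.obj ⊗ f.obj ⟶ g.obj) :
    lDiagram ν ζ = lArc a.obj ν ζ :=
  (lArc_simple _ _).symm

theorem rDiagram_eq_rArc (μ : c.obj ⟶ d.obj ⊗ b.obj) (γ : g.obj ⊗ b.obj ⟶ h.obj) :
    rDiagram μ γ = rArc b.obj μ γ :=
  (rArc_simple _ _).symm

/-- Generators are either recovered by the retraction or belong to the mismatched span. For `x` in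
the kernel the subtracted term vanishes, which bounds the kernel from above. -/
theorem sub_tubeToL_lToTube_mem (x : LTube C) : x - tubeToL (lToTube x) ∈ lMismatch C := by
  induction x using LTube.arc_induction with
  | zero => simp
  | add x₁ x₂ h₁ h₂ =>
    rw [map_add, map_add, add_sub_add_comm]
    exact add_mem h₁ h₂
  | of a d e f g ν ζ =>
    by_cases hdg : SameColumn d g
    · rw [tubeToL_lToTube hdg, sub_self]
      exact zero_mem _
    · rw [lToTube_eq_zero hdg, map_zero, sub_zero]
      exact Submodule.subset_span ⟨a, d, e, f, g, ν, ζ, hdg, (lDiagram_eq_lArc ν ζ).symm⟩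

theorem sub_tubeToR_rToTube_mem (x : RTube C) : x - tubeToR (rToTube x) ∈ rMismatch C := by
  induction x using RTube.arc_induction with
  | zero => simp
  | add x₁ x₂ h₁ h₂ =>
    rw [map_add, map_add, add_sub_add_comm]
    exact add_mem h₁ h₂
  | of b c d g h μ γ =>
    by_cases hch : SameRow c h
    · rw [tubeToR_rToTube hch, sub_self]
      exact zero_mem _
    · rw [rToTube_eq_zero hch, map_zero, sub_zero]
      exact Submodule.subset_span ⟨b, c, d, g, h, μ, γ, hch, (rDiagram_eq_rArc μ γ).symm⟩

theorem ker_lToTube : LinearMap.ker (lToTube (C := C)) = lMismatch C := by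
  apply le_antisymm
  · intro x hx
    have := sub_tubeToL_lToTube_mem x
    rwa [LinearMap.mem_ker.1 hx, map_zero, sub_zero] at this
  · refine Submodule.span_le.2 ?_
    rintro _ ⟨a, d, e, f, g, ν, ζ, hdg, rfl⟩
    rw [lDiagram_eq_lArc]
    exact lToTube_eq_zero hdg ν ζ

theorem ker_rToTube : LinearMap.ker (rToTube (C := C)) = rMismatch C := by
  apply le_antisymm
  · intro x hx
    have := sub_tubeToR_rToTube_mem x
    rwa [LinearMap.mem_ker.1 hx, map_zero, sub_zero] at this
  · refine Submodule.span_le.2 ?_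
    rintro _ ⟨b, c, d, g, h, μ, γ, hch, rfl⟩
    rw [rDiagram_eq_rArc]
    exact rToTube_eq_zero hch μ γ

/-! ### Injectivity for a simple tensor unit -/

theorem exists_unit_iso [Simple (𝟙_ C)] : ∃ j : Irr C, IsUnitLabel j ∧ Nonempty (𝟙_ C ≅ j.obj) := by
  obtain ⟨j, ⟨i⟩⟩ := exists_irr_iso (𝟙_ C) inferInstance
  refine ⟨j, ⟨i.hom, fun h => id_nonzero (𝟙_ C) ?_⟩, ⟨i⟩⟩
  rw [← i.hom_inv_id, h, zero_comp]

/-- The unit has a single summand `j ≅ 𝟙`, and `z ⊗ j ≅ z` is nonzero for every simple `z`, so there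
is only one column. -/
theorem sameColumn_of_simple_unit [Simple (𝟙_ C)] (x y : Irr C) : SameColumn x y := by
  obtain ⟨j, hj, ⟨i⟩⟩ := exists_unit_iso (C := C)
  have key : ∀ z : Irr C, ¬ IsZero (z.obj ⊗ j.obj) := fun z hz => by
    have : Simple z.obj := z.2
    exact Simple.not_isZero z.obj (hz.of_iso ((ρ_ z.obj).symm ≪≫ whiskerLeftIso z.obj i))
  exact ⟨j, hj, key x, key y⟩

theorem sameRow_of_simple_unit [Simple (𝟙_ C)] (x y : Irr C) : SameRow x y := by
  obtain ⟨j, hj, ⟨i⟩⟩ := exists_unit_iso (C := C)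
  have key : ∀ z : Irr C, ¬ IsZero (j.obj ⊗ z.obj) := fun z hz => by
    have : Simple z.obj := z.2
    exact Simple.not_isZero z.obj (hz.of_iso ((λ_ z.obj).symm ≪≫ whiskerRightIso i z.obj))
  exact ⟨j, hj, key x, key y⟩

theorem lToTube_injective [Simple (𝟙_ C)] : Function.Injective (lToTube (C := C)) := by
  rw [← LinearMap.ker_eq_bot, ker_lToTube, lMismatch, Submodule.span_eq_bot]
  rintro _ ⟨a, d, e, f, g, ν, ζ, hdg, rfl⟩
  exact absurd (sameColumn_of_simple_unit d g) hdg

theorem rToTube_injective [Simple (𝟙_ C)] : Function.Injective (rToTube (C := C)) := by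
  rw [← LinearMap.ker_eq_bot, ker_rToTube, rMismatch, Submodule.span_eq_bot]
  rintro _ ⟨b, c, d, g, h, μ, γ, hch, rfl⟩
  exact absurd (sameRow_of_simple_unit c h) hch

end Kernel

end TubeAlgebra

end

theorem mainTheorem5 (C : Type u) [Category.{v} C] [Abelian C] [Linear ℂ C]
    [MonoidalCategory C] [MonoidalPreadditive C] [MonoidalLinear ℂ C] [RigidCategory C]
    [TubeAlgebra.MultifusionCategory C] :
    -- the four spaces with their multiplications and units are algebras
    (TubeAlgebra.IsAlgebra (TubeAlgebra.tubeMul (C := C)) TubeAlgebra.tubeOne ∧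
      TubeAlgebra.IsAlgebra (TubeAlgebra.lMul (C := C)) TubeAlgebra.lOne ∧
      TubeAlgebra.IsAlgebra (TubeAlgebra.rMul (C := C)) TubeAlgebra.rOne ∧
      TubeAlgebra.IsAlgebra (TubeAlgebra.crossMul (C := C)) TubeAlgebra.crossOne) ∧
    -- the left boundary tube algebra inside the bulk tube algebra
    ((∀ x y : TubeAlgebra.LTube C, TubeAlgebra.lToTube (TubeAlgebra.lMul x y) =
        TubeAlgebra.tubeMul (TubeAlgebra.lToTube x) (TubeAlgebra.lToTube y)) ∧
      TubeAlgebra.lToTube (C := C) TubeAlgebra.lOne = TubeAlgebra.tubeOne ∧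
      (∀ x : TubeAlgebra.LTube C, TubeAlgebra.tubeComul (TubeAlgebra.lToTube x) =
        TensorProduct.map TubeAlgebra.lToTube TubeAlgebra.lToTube (TubeAlgebra.lComul x)) ∧
      (∀ x : TubeAlgebra.LTube C,
        TubeAlgebra.tubeCounit (TubeAlgebra.lToTube x) = TubeAlgebra.lCounit x) ∧
      LinearMap.range (TubeAlgebra.lToTube (C := C)) = TubeAlgebra.leftPart C ∧
      LinearMap.ker (TubeAlgebra.lToTube (C := C)) = TubeAlgebra.lMismatch C ∧
      (Simple (𝟙_ C) → Function.Injective (TubeAlgebra.lToTube (C := C)))) ∧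
    -- the right boundary tube algebra inside the bulk tube algebra
    ((∀ x y : TubeAlgebra.RTube C, TubeAlgebra.rToTube (TubeAlgebra.rMul x y) =
        TubeAlgebra.tubeMul (TubeAlgebra.rToTube x) (TubeAlgebra.rToTube y)) ∧
      TubeAlgebra.rToTube (C := C) TubeAlgebra.rOne = TubeAlgebra.tubeOne ∧
      (∀ x : TubeAlgebra.RTube C, TubeAlgebra.tubeComul (TubeAlgebra.rToTube x) =
        TensorProduct.map TubeAlgebra.rToTube TubeAlgebra.rToTube (TubeAlgebra.rComul x)) ∧
      (∀ x : TubeAlgebra.RTube C,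
        TubeAlgebra.tubeCounit (TubeAlgebra.rToTube x) = TubeAlgebra.rCounit x) ∧
      LinearMap.range (TubeAlgebra.rToTube (C := C)) = TubeAlgebra.rightPart C ∧
      LinearMap.ker (TubeAlgebra.rToTube (C := C)) = TubeAlgebra.rMismatch C ∧
      (Simple (𝟙_ C) → Function.Injective (TubeAlgebra.rToTube (C := C)))) ∧
    -- gluing is an isomorphism from the crossed product to the bulk tube algebra
    ∃ Φ : TubeAlgebra.CrossedProduct C ≃ₗ[ℂ] TubeAlgebra.Tube C,
      (∀ (a b c d e f g h : TubeAlgebra.Irr C) (μ : c.obj ⟶ d.obj ⊗ b.obj)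
        (ν : d.obj ⟶ a.obj ⊗ e.obj) (ζ : a.obj ⊗ f.obj ⟶ g.obj) (γ : g.obj ⊗ b.obj ⟶ h.obj),
        Φ (TubeAlgebra.cross (TubeAlgebra.rDiagram μ γ) (TubeAlgebra.lDiagram ν ζ)) =
          TubeAlgebra.diagram μ ν ζ γ) ∧
      (∀ (a b c d d' e f g g' h : TubeAlgebra.Irr C) (μ : c.obj ⟶ d.obj ⊗ b.obj)
        (ν : d'.obj ⟶ a.obj ⊗ e.obj) (ζ : a.obj ⊗ f.obj ⟶ g'.obj) (γ : g.obj ⊗ b.obj ⟶ h.obj),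
        (d ≠ d' ∨ g ≠ g') →
          Φ (TubeAlgebra.cross (TubeAlgebra.rDiagram μ γ) (TubeAlgebra.lDiagram ν ζ)) = 0) ∧
      (∀ (r : TubeAlgebra.RTube C) (l : TubeAlgebra.LTube C), Φ (TubeAlgebra.cross r l) =
        TubeAlgebra.tubeMul (TubeAlgebra.rToTube r) (TubeAlgebra.lToTube l)) ∧
      (∀ x y : TubeAlgebra.CrossedProduct C,
        Φ (TubeAlgebra.crossMul x y) = TubeAlgebra.tubeMul (Φ x) (Φ y)) ∧
      Φ TubeAlgebra.crossOne = TubeAlgebra.tubeOne ∧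
      (∀ x : TubeAlgebra.CrossedProduct C, TubeAlgebra.tubeComul (Φ x) =
        TensorProduct.map Φ.toLinearMap Φ.toLinearMap (TubeAlgebra.crossComul x)) := by
  refine ⟨⟨TubeAlgebra.isAlgebra_tube, TubeAlgebra.isAlgebra_lTube, TubeAlgebra.isAlgebra_rTube,
    TubeAlgebra.isAlgebra_crossedProduct⟩,
    ⟨TubeAlgebra.lToTube_lMul, TubeAlgebra.lToTube_lOne, TubeAlgebra.tubeComul_lToTube,
      TubeAlgebra.tubeCounit_lToTube, TubeAlgebra.range_lToTube, TubeAlgebra.ker_lToTube,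
      fun _ => TubeAlgebra.lToTube_injective⟩,
    ⟨TubeAlgebra.rToTube_rMul, TubeAlgebra.rToTube_rOne, TubeAlgebra.tubeComul_rToTube,
      TubeAlgebra.tubeCounit_rToTube, TubeAlgebra.range_rToTube, TubeAlgebra.ker_rToTube,
      fun _ => TubeAlgebra.rToTube_injective⟩,
    TubeAlgebra.crossEquiv, ?_, ?_, TubeAlgebra.crossEquiv_cross, TubeAlgebra.crossEquiv_crossMul,
    TubeAlgebra.crossEquiv_crossOne, TubeAlgebra.tubeComul_crossEquiv⟩
  · intro a b c d e f g h μ ν ζ γ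
    rw [TubeAlgebra.rDiagram_eq_rArc, TubeAlgebra.lDiagram_eq_lArc, TubeAlgebra.crossEquiv_arc,
      TubeAlgebra.diagram_eq_arc]
    simp
  · intro a b c d d' e f g g' h μ ν ζ γ hne
    rw [TubeAlgebra.rDiagram_eq_rArc, TubeAlgebra.lDiagram_eq_lArc,
      TubeAlgebra.cross_eq_zero hne, map_zero]
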